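/- A metric space is called boundedly compact (bcm) if all its closed bounded subsets are compact. A rooted-and-measured bcm space is a quadruple $\mathcal X=(X,d^X,\rho_X,\mu_X)$, where $(X,d^X)$ is a bcm space, $\rho_X\in X$ is its root and $\mu_X$ is a Radon measure on $X$. Write $D(\rho,r)$ for the closed ball of radius $r$ about $\rho$. Let $(Z,d^Z,\rho_Z)$ be a rooted bcm space. For closed sets $A,B\subseteq Z$ the local Hausdorff distance is $$d_{\mathrm H}^{Z,\rho_Z}(A,B)=\int_0^\infty e^{-r}\bigl(1\wedge d^Z_{\mathrm H}(A\cap D(\rho_Z,r),\,B\cap D(\rho_Z,r))\bigr)\,dr,$$ where $d_{\mathrm H}^Z$ is the Hausdorff distance, with value $\infty$ if exactly one of the two sets is empty; the topology that it induces on the closed subsets of $Z$ is the Fell topology, and it does not depend on $\rho_Z$. For $\kappa\in(0,1]$ and $f:Z\to\mathbb R$ put $$\|f\|_{\mathrm{BL}^\kappa(Z)}=\sup_{z\in Z}|f(z)|+\sup_{x\ne y}\frac{|f(x)-f(y)|}{d^Z(x,y)^\kappa}$$ (the second supremum is $0$ if $Z$ is a singleton), for finite Radon measures $\mu,\nu$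 on $Z$ put $$d^Z_{\mathrm{BL}^\kappa}(\mu,\nu)=\sup\Bigl\{\Bigl|\int f\,d\mu-\int f\,d\nu\Bigr|:\|f\|_{\mathrm{BL}^\kappa(Z)}\le1\Bigr\},$$ and for Radon measures $\mu,\nu$ on $Z$ put $$d^{Z,\rho_Z}_{\mathrm{BL}^\kappa}(\mu,\nu)=\int_0^\infty e^{-r}\bigl(1\wedge d^Z_{\mathrm{BL}^\kappa}(\mu^{(r)},\nu^{(r)})\bigr)\,dr,\qquad \mu^{(r)}=\mu(\,\cdot\cap D(\rho_Z,r)).$$ Let $d_{\mathrm P}^{Z,\rho_Z}(\mu,\nu)$ be defined by the same integral with the Prokhorov distance $d_{\mathrm P}^Z$ in place of $d^Z_{\mathrm{BL}^\kappa}$. For rooted-and-measured bcm spaces $\mathcal X,\mathcal Y$ let $$d^{\tau,\mathrm{BL}^\kappa}_{\mathfrak M_\bullet}(\mathcal X,\mathcal Y)=\inf_{f,g,Z}\Bigl\{d_{\mathrm H}^{Z,\rho_Z}(f(X),g(Y))\vee d^{Z,\rho_Z}_{\mathrm{BL}^\kappa}(\mu_X\circ f^{-1},\mu_Y\circ g^{-1})\Bigr\},$$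 where the infimum is over all rooted bcm spaces $(Z,d^Z,\rho_Z)$ and all root-preserving isometric embeddings $f:X\to Z$, $g:Y\to Z$. The Gromov–Hausdorff-vague topology is the topology induced by the distance that is defined in the same way with $d_{\mathrm P}^{Z,\rho_Z}$ in place of $d^{Z,\rho_Z}_{\mathrm{BL}^\kappa}$. **Theorem.** Let $\kappa\in(0,1]$, and let $\mathcal X_n=(X_n,d^{X_n},\rho_{X_n},\mu_{X_n})$ $(n\in\mathbb N)$ and $\mathcal X=(X,d^X,\rho_X,\mu_X)$ be rooted-and-measured bcm spaces. The following conditions are equivalent. (i) There exist a rooted bcm space $(M,d^M,\rho_M)$ and root-preserving isometric embeddings $f_n:X_n\to M$, $f:X\to M$ such that $f_n(X_n)\to f(X)$ in the Fell topology and $\mu_{X_n}\circ f_n^{-1}\to\mu_X\circ f^{-1}$ vaguely. (ii) There exist a bcm space $(M,d^M)$ and isometric embeddings $f_n:X_n\to M$, $f:X\to M$ such that $f_n(X_n)\to f(X)$ in the Fell topology, $f_n(\rho_{X_n})\to f(\rho_X)$ in $M$, and $\mu_{X_n}\circ f_n^{-1}\to\mu_X\circ f^{-1}$ vaguely. (iii)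 $d^{\tau,\mathrm{BL}^\kappa}_{\mathfrak M_\bullet}(\mathcal X_n,\mathcal X)\to0$. (iv) $\mathcal X_n$ converges to $\mathcal X$ in the Gromov–Hausdorff-vague topology. Here vague convergence means convergence of the integrals of all compactly supported continuous real functions. -/

import Mathlib

open MeasureTheory Filter Topology
open scoped ENNReal

universe u

/-! ### Boundedly compact spaces with a root and a measure -/

/-- A boundedly compact metric space: closed bounded sets are compact (`ProperSpace`).
It carries its Borel σ-algebra. -/
structure BCM : Type (u + 1) where
  carrier : Type u
  [metric : MetricSpace carrier]
  [proper : ProperSpace carrier]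
  [meas : MeasurableSpace carrier]
  [borel : BorelSpace carrier]

/-- A rooted boundedly compact metric space. -/
structure RootedBCM : Type (u + 1) extends BCM.{u} where
  root : carrier

/-- A rooted boundedly compact metric space with a (nonnegative) Radon measure. -/
structure RootedMeasuredBCM : Type (u + 1) extends RootedBCM.{u} where
  μ : Measure carrier
  [radon : μ.Regular]

instance : CoeSort BCM.{u} (Type u) := ⟨BCM.carrier⟩
instance : CoeSort RootedBCM.{u} (Type u) := ⟨fun X => X.carrier⟩
instance : CoeSort RootedMeasuredBCM.{u} (Type u) := ⟨fun X => X.carrier⟩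

attribute [instance] BCM.metric BCM.proper BCM.meas BCM.borel RootedMeasuredBCM.radon

/-! ### Distances between measures and between closed sets -/

/-- The norm `‖f‖ = sup |f| + sup_{x ≠ y} |f x - f y| / d(x, y) ^ κ`, with values in `[0, ∞]`. -/
noncomputable def blNorm {Z : Type u} [MetricSpace Z] (κ : ℝ) (f : Z → ℝ) : ℝ≥0∞ :=
  (⨆ z, ‖f z‖ₑ) + ⨆ (x : Z) (y : Z) (_ : x ≠ y), ‖f x - f y‖ₑ / edist x y ^ κ

/-- The bounded Lipschitz distance with exponent `κ` between two finite measures: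
the supremum of `|∫ f dμ - ∫ f dν|` over the functions with `‖f‖ ≤ 1`. -/
noncomputable def blDist {Z : Type u} [MetricSpace Z] [MeasurableSpace Z]
    (κ : ℝ) (μ ν : Measure Z) : ℝ≥0∞ :=
  ⨆ (f : Z → ℝ) (_ : blNorm κ f ≤ 1), ‖∫ z, f z ∂μ - ∫ z, f z ∂ν‖ₑ

/-- `∫_0^∞ e^{-r} (1 ∧ F r) dr`. -/
noncomputable def localize (F : ℝ → ℝ≥0∞) : ℝ≥0∞ :=
  ∫⁻ r in Set.Ioi (0 : ℝ), ENNReal.ofReal (Real.exp (-r)) * min 1 (F r)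

/-- The local Hausdorff distance with respect to the root `ρ`. -/
noncomputable def localHausdorffDist {Z : Type u} [MetricSpace Z] (ρ : Z) (A B : Set Z) : ℝ≥0∞ :=
  localize fun r =>
    Metric.hausdorffEDist (A ∩ Metric.closedBall ρ r) (B ∩ Metric.closedBall ρ r)

/-- The rooted bounded Lipschitz distance with exponent `κ` between Radon measures. -/
noncomputable def rootedBLDist {Z : Type u} [MetricSpace Z] [MeasurableSpace Z]
    (κ : ℝ) (ρ : Z) (μ ν : Measure Z) : ℝ≥0∞ :=
  localize fun r =>
    blDist κ (μ.restrict (Metric.closedBall ρ r)) (ν.restrict (Metric.closedBall ρ r))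

/-- The rooted Prokhorov distance between Radon measures. -/
noncomputable def rootedProkhorovDist {Z : Type u} [MetricSpace Z] [MeasurableSpace Z]
    (ρ : Z) (μ ν : Measure Z) : ℝ≥0∞ :=
  localize fun r =>
    levyProkhorovEDist (μ.restrict (Metric.closedBall ρ r)) (ν.restrict (Metric.closedBall ρ r))

/-! ### Modes of convergence in a fixed space -/

/-- Convergence of closed sets in the Fell topology, i.e. the topology induced by the local
Hausdorff distance. This topology does not depend on the root, and no root is singled out here. -/
def FellTendsto {Z : Type u} [MetricSpace Z] (A : ℕ → Set Z) (B : Set Z) : Prop :=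
  ∀ ρ : Z, Tendsto (fun n => localHausdorffDist ρ (A n) B) atTop (𝓝 0)

/-- Vague convergence: convergence of the integrals of all continuous functions with compact
support. -/
def VagueTendsto {Z : Type u} [MetricSpace Z] [MeasurableSpace Z]
    (μ : ℕ → Measure Z) (ν : Measure Z) : Prop :=
  ∀ f : Z → ℝ, Continuous f → HasCompactSupport f →
    Tendsto (fun n => ∫ z, f z ∂(μ n)) atTop (𝓝 (∫ z, f z ∂ν))

/-! ### Gromov-Hausdorff-type distances -/

/-- Root-preserving isometric embeddings. -/
structure RootedEmbedding (X Y : RootedBCM.{u}) : Type u where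
  toFun : X → Y
  isometry : Isometry toFun
  map_root : toFun X.root = Y.root

instance (X Y : RootedBCM.{u}) : CoeFun (RootedEmbedding X Y) (fun _ => X → Y) :=
  ⟨RootedEmbedding.toFun⟩

/-- The Gromov-Hausdorff-type distance built from the local Hausdorff distance and the rooted
bounded Lipschitz distance with exponent `κ`. -/
noncomputable def ghBLDist (κ : ℝ) (X Y : RootedMeasuredBCM.{u}) : ℝ≥0∞ :=
  ⨅ (Z : RootedBCM.{u}) (f : RootedEmbedding X.toRootedBCM Z)
    (g : RootedEmbedding Y.toRootedBCM Z),
    max (localHausdorffDist Z.root (Set.range f) (Set.range g))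
      (rootedBLDist κ Z.root (X.μ.map f) (Y.μ.map g))

/-- The Gromov-Hausdorff-vague distance, built in the same way from the local Hausdorff distance
and the rooted Prokhorov distance. -/
noncomputable def ghVagueDist (X Y : RootedMeasuredBCM.{u}) : ℝ≥0∞ :=
  ⨅ (Z : RootedBCM.{u}) (f : RootedEmbedding X.toRootedBCM Z)
    (g : RootedEmbedding Y.toRootedBCM Z),
    max (localHausdorffDist Z.root (Set.range f) (Set.range g))
      (rootedProkhorovDist Z.root (X.μ.map f) (Y.μ.map g))

/-- Convergence in the Gromov-Hausdorff-vague topology, the topology induced by the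
Gromov-Hausdorff-vague distance. -/
def GHVagueTendsto (X : ℕ → RootedMeasuredBCM.{u}) (Y : RootedMeasuredBCM.{u}) : Prop :=
  Tendsto (fun n => ghVagueDist (X n) Y) atTop (𝓝 0)

/-! ### The functional `localize` -/

/-! Every condition is compared with (i). Two facts about `localize` translate the integrated
distances into concrete statements. A value below `exp (-(R + 1)) * δ` forces `F r < δ` at some
radius `r` in `[R, R + 1]`, and one such radius is enough to compare sets inside radius `R` and
integrals of test functions supported there. Conversely, convergence at almost every radius gives
convergence of the integral (`tendsto_localize`). For a limit set or a limit measure only countably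
many radii are bad: those where the sphere carries points of the set not approached from inside, and
those where the sphere has positive mass.

From (i) to (iii) and (iv): at a good radius, vague convergence is uniform over the bounded
Lipschitz unit ball by Arzelà–Ascoli (`VagueTendsto.tendsto_blDist_restrict`), and the case `κ = 1`
controls the Prokhorov distance (`levyProkhorovEDist_le_of_blDist_le`).

From (iii) or (iv) to (i): near-optimal embeddings into spaces `Z n` give `HasCloseEmbeddings` with
a constant independent of `n`. The `Z n` are glued along their copies of `X`
(`exists_isometry_glue`). The result need not be boundedly compact, but the union of the embedded
copies is (`isCompact_union_range_inter_closedBall`), and on that union convergence is tested on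
Lipschitz functions (`convergesInCommonSpace_of_isometry`).

From (ii) to (i): embed `M` into `ℓ^∞` and translate each copy so that its root becomes `0`. The
translations differ from that of the limit by vectors tending to `0`, so the same criterion applies.
-/

theorem exists_lt_of_localize_lt {F : ℝ → ℝ≥0∞} {R : ℝ} (hR : 0 ≤ R) {δ : ℝ≥0∞} (hδ : δ ≤ 1)
    (h : localize F < ENNReal.ofReal (Real.exp (-(R + 1))) * δ) :
    ∃ r, R ≤ r ∧ r ≤ R + 1 ∧ F r < δ := by
  by_contra! hF
  refine absurd h (not_lt.2 ?_)
  calc ENNReal.ofReal (Real.exp (-(R + 1))) * δ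
      = ∫⁻ _ in Set.Ioc R (R + 1), ENNReal.ofReal (Real.exp (-(R + 1))) * δ := by
        simp
    _ ≤ ∫⁻ r in Set.Ioc R (R + 1), ENNReal.ofReal (Real.exp (-r)) * min 1 (F r) := by
        refine setLIntegral_mono' measurableSet_Ioc fun r hr => ?_
        gcongr
        · exact hr.2
        · exact le_min hδ (hF r hr.1.le hr.2)
    _ ≤ localize F :=
        lintegral_mono_set fun r hr => lt_of_le_of_lt hR hr.1

/-- Dominated convergence with majorant `exp (-r)`. No measurability of `F n` is available, so each
integrand is first replaced by a measurable minorant with the same lower integral. -/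
theorem tendsto_localize {F : ℕ → ℝ → ℝ≥0∞}
    (h : ∀ᵐ r : ℝ, Tendsto (fun n => F n r) atTop (𝓝 0)) :
    Tendsto (fun n => localize (F n)) atTop (𝓝 0) := by
  choose g hgm hgle hgeq using fun n => exists_measurable_le_lintegral_eq
    (μ := volume.restrict (Set.Ioi (0 : ℝ)))
    (fun r => ENNReal.ofReal (Real.exp (-r)) * min 1 (F n r))
  have hg : ∀ n, localize (F n) = ∫⁻ r in Set.Ioi (0 : ℝ), g n r := hgeq
  simp_rw [hg]
  have := tendsto_lintegral_of_dominated_convergence (μ := volume.restrict (Set.Ioi (0 : ℝ)))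
    (F := g) (f := fun _ => 0) (fun r => ENNReal.ofReal (Real.exp (-r))) hgm
    (fun n => Eventually.of_forall fun r => (hgle n r).trans
      ((mul_le_mul_right (min_le_left 1 (F n r)) _).trans_eq (mul_one _)))
    ((integrableOn_exp_neg_Ioi 0).lintegral_lt_top.ne)
    (ae_restrict_of_ae (h.mono fun r hr => ?_))
  · simpa using this
  · refine tendsto_of_tendsto_of_tendsto_of_le_of_le tendsto_const_nhds ?_ (fun n => zero_le)
      (fun n => (hgle n r).trans (mul_le_mul_right (min_le_right 1 (F n r)) _))
    simpa using ENNReal.Tendsto.const_mul hr (Or.inr ENNReal.ofReal_ne_top)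

/-! ### Local closeness of sets and the Fell topology -/

/-- Inside the closed ball of radius `R` about `ρ`, each of the two sets lies in the
`δ`-neighbourhood of the other. -/
def LocallyClose {Z : Type u} [MetricSpace Z] (ρ : Z) (R δ : ℝ) (A B : Set Z) : Prop :=
  (∀ a ∈ A, dist a ρ ≤ R → ∃ b ∈ B, dist a b < δ) ∧
    ∀ b ∈ B, dist b ρ ≤ R → ∃ a ∈ A, dist b a < δ

theorem LocallyClose.mono {Z : Type u} [MetricSpace Z] {ρ ρ' : Z} {R R' δ δ' : ℝ} {A B : Set Z}
    (h : LocallyClose ρ R δ A B) (hR : R' + dist ρ' ρ ≤ R) (hδ : δ ≤ δ') :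
    LocallyClose ρ' R' δ' A B := by
  refine ⟨fun a ha har => ?_, fun b hb hbr => ?_⟩
  · obtain ⟨b, hb, hab⟩ := h.1 a ha (by linarith [dist_triangle a ρ' ρ])
    exact ⟨b, hb, hab.trans_le hδ⟩
  · obtain ⟨a, ha, hab⟩ := h.2 b hb (by linarith [dist_triangle b ρ' ρ])
    exact ⟨a, ha, hab.trans_le hδ⟩

theorem locallyClose_of_localHausdorffDist_lt {Z : Type u} [MetricSpace Z] {ρ : Z} {A B : Set Z}
    {R δ : ℝ} (hR : 0 ≤ R) (hδ : δ ≤ 1)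
    (h : localHausdorffDist ρ A B <
      ENNReal.ofReal (Real.exp (-(R + 1))) * ENNReal.ofReal δ) : LocallyClose ρ R δ A B := by
  obtain ⟨r, hRr, -, hr⟩ := exists_lt_of_localize_lt hR (by simpa using hδ) h
  refine ⟨fun a ha har => ?_, fun b hb hbr => ?_⟩
  · obtain ⟨b, hb, hab⟩ := Metric.exists_edist_lt_of_hausdorffEDist_lt
      (x := a) (Set.mem_inter ha (Metric.mem_closedBall.2 (har.trans hRr))) hr
    exact ⟨b, hb.1, by rwa [edist_lt_ofReal] at hab⟩
  · rw [Metric.hausdorffEDist_comm] at hr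
    obtain ⟨a, ha, hab⟩ := Metric.exists_edist_lt_of_hausdorffEDist_lt
      (x := b) (Set.mem_inter hb (Metric.mem_closedBall.2 (hbr.trans hRr))) hr
    exact ⟨a, ha.1, by rwa [edist_lt_ofReal] at hab⟩

theorem FellTendsto.eventually_locallyClose {Z : Type u} [MetricSpace Z] {A : ℕ → Set Z}
    {B : Set Z} (h : FellTendsto A B) (ρ : Z) (R : ℝ) {δ : ℝ} (hδ : 0 < δ) :
    ∀ᶠ n in atTop, LocallyClose ρ R δ (A n) B := by
  have hpos : 0 < ENNReal.ofReal (Real.exp (-(max R 0 + 1))) * ENNReal.ofReal (min δ 1) :=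
    ENNReal.mul_pos (by simp [Real.exp_pos]) (by simp [hδ])
  filter_upwards [(h ρ).eventually (gt_mem_nhds hpos)] with n hn
  exact (locallyClose_of_localHausdorffDist_lt (le_max_right _ _) (min_le_right _ _) hn).mono
    (by simp) (min_le_left _ _)

/-- Each bad radius `r` gets a basic open set `U r` that meets `B` on the sphere but misses `B` in
the open ball. If `r < s` shared one such set, its point at distance `r` would lie in the open ball
of radius `s`. Hence `U` is injective into a countable basis. -/
theorem countable_setOf_notMem_closure_inter_ball {Z : Type u} [MetricSpace Z]
    [SecondCountableTopology Z] (ρ : Z) (B : Set Z) :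
    {r : ℝ | ∃ b ∈ B, dist b ρ = r ∧ b ∉ closure (B ∩ Metric.ball ρ r)}.Countable := by
  have key : ∀ r ∈ {r : ℝ | ∃ b ∈ B, dist b ρ = r ∧ b ∉ closure (B ∩ Metric.ball ρ r)},
      ∃ U ∈ TopologicalSpace.countableBasis Z,
        (∃ b ∈ B, dist b ρ = r ∧ b ∈ U) ∧ Disjoint U (B ∩ Metric.ball ρ r) := by
    rintro r ⟨b, hb, hbr, hbc⟩
    obtain ⟨U, hU, hbU, hUs⟩ := (TopologicalSpace.isBasis_countableBasis Z).exists_subset_of_mem_open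
      (Set.mem_compl hbc) isClosed_closure.isOpen_compl
    refine ⟨U, hU, ⟨b, hb, hbr, hbU⟩, ?_⟩
    exact Set.disjoint_left.2 fun x hx hx' => hUs hx (subset_closure hx')
  choose! U hU hUb hUd using key
  refine Set.MapsTo.countable_of_injOn (f := U) (fun r hr => hU r hr) ?_
    (TopologicalSpace.countable_countableBasis Z)
  have aux : ∀ r ∈ {r : ℝ | ∃ b ∈ B, dist b ρ = r ∧ b ∉ closure (B ∩ Metric.ball ρ r)},
      ∀ s ∈ {r : ℝ | ∃ b ∈ B, dist b ρ = r ∧ b ∉ closure (B ∩ Metric.ball ρ r)},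
      U r = U s → s ≤ r := by
    intro r hr s hs hrs
    by_contra! hlt
    obtain ⟨b, hb, hbr, hbU⟩ := hUb r hr
    exact Set.disjoint_left.1 (hUd s hs) (hrs ▸ hbU) ⟨hb, by simpa [hbr] using hlt⟩
  exact fun r hr s hs hrs => le_antisymm (aux s hs r hr hrs.symm) (aux r hr s hs hrs)

/-- The points of `B` within `r + 1` of `ρ` that are not `ε`-close to `B ∩ closedBall ρ r` form a
compact set lying strictly outside that ball, so their distance to `ρ` stays away from `r`. -/
theorem exists_pos_forall_dist_le_add_exists {Z : Type u} [MetricSpace Z] [ProperSpace Z]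
    {B : Set Z} (hB : IsClosed B) (ρ : Z) (r : ℝ) {ε : ℝ} (hε : 0 < ε) :
    ∃ η > 0, ∀ b ∈ B, dist b ρ ≤ r + η → ∃ b' ∈ B, dist b' ρ ≤ r ∧ dist b b' < ε := by
  set K := (B ∩ Metric.closedBall ρ (r + 1)) \ Metric.thickening ε (B ∩ Metric.closedBall ρ r)
    with hK
  have hKc : IsCompact K :=
    ((isCompact_closedBall ρ (r + 1)).inter_left hB).diff Metric.isOpen_thickening
  have main : ∀ η ≤ 1, (∀ b ∈ K, r + η < dist b ρ) → ∀ b ∈ B, dist b ρ ≤ r + η →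
      ∃ b' ∈ B, dist b' ρ ≤ r ∧ dist b b' < ε := by
    intro η hη hKη b hb hbr
    by_cases hbt : b ∈ Metric.thickening ε (B ∩ Metric.closedBall ρ r)
    · obtain ⟨b', hb', hd⟩ := Metric.mem_thickening_iff.1 hbt
      exact ⟨b', hb'.1, hb'.2, hd⟩
    · have := hKη b ⟨⟨hb, Metric.mem_closedBall.2 (by linarith)⟩, hbt⟩
      linarith
  rcases K.eq_empty_or_nonempty with hKe | hKn
  · exact ⟨1, one_pos, main 1 le_rfl (by simp [hKe])⟩
  · obtain ⟨x, hxK, hx⟩ := hKc.exists_isMinOn hKn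
      (f := fun z => dist z ρ) (by fun_prop)
    have hxr : r < dist x ρ := by
      by_contra! hle
      exact hxK.2 (Metric.self_subset_thickening hε _ ⟨hxK.1.1, hle⟩)
    refine ⟨min 1 ((dist x ρ - r) / 2), by simp [hxr], main _ (min_le_left _ _) fun b hb => ?_⟩
    have h1 : dist x ρ ≤ dist b ρ := hx hb
    have h2 := min_le_right 1 ((dist x ρ - r) / 2)
    linarith

theorem tendsto_hausdorffEDist_inter_closedBall {Z : Type u} [MetricSpace Z] [ProperSpace Z]
    {A : ℕ → Set Z} {B : Set Z} (hB : IsClosed B) {ρ : Z}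
    (h : ∀ R δ : ℝ, 0 < δ → ∀ᶠ n in atTop, LocallyClose ρ R δ (A n) B) {r : ℝ}
    (hr : ∀ b ∈ B, dist b ρ = r → b ∈ closure (B ∩ Metric.ball ρ r)) :
    Tendsto (fun n => Metric.hausdorffEDist (A n ∩ Metric.closedBall ρ r)
      (B ∩ Metric.closedBall ρ r)) atTop (𝓝 0) := by
  have hcl : B ∩ Metric.closedBall ρ r ⊆ closure (B ∩ Metric.ball ρ r) := by
    rintro b ⟨hb, hbr⟩
    rcases (Metric.mem_closedBall.1 hbr).lt_or_eq with hlt | heq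
    · exact subset_closure ⟨hb, hlt⟩
    · exact hr b hb heq
  have key : ∀ ε : ℝ, 0 < ε → ∀ᶠ n in atTop, Metric.hausdorffEDist
      (A n ∩ Metric.closedBall ρ r) (B ∩ Metric.closedBall ρ r) ≤ ENNReal.ofReal ε := by
    intro ε hε
    obtain ⟨η, hη, hηB⟩ := exists_pos_forall_dist_le_add_exists hB ρ r (half_pos hε)
    -- Centres are taken in the open ball, which is dense enough at a good radius. Each centre `y`
    -- then has room `r - dist y ρ`, so a sufficiently close point of `A n` stays in the closed
    -- ball.
    obtain ⟨t, htB, htf, hcov⟩ :=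
      ((isCompact_closedBall ρ r).inter_left hB).elim_finite_subcover_image
      (b := B ∩ Metric.ball ρ r) (c := fun y => Metric.ball y (ε / 2))
      (fun _ _ => Metric.isOpen_ball) (by
        intro x hx
        obtain ⟨y, hy, hxy⟩ := Metric.mem_closure_iff.1 (hcl hx) (ε / 2) (half_pos hε)
        exact Set.mem_biUnion hy hxy)
    have hev : ∀ᶠ n in atTop, ∀ y ∈ t, ∃ a ∈ A n, dist y a < min (ε / 2) (r - dist y ρ) := by
      refine (htf.eventually_all).2 fun y hy => ?_
      have hyr : dist y ρ < r := (htB hy).2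
      filter_upwards [h r (min (ε / 2) (r - dist y ρ))
        (lt_min (half_pos hε) (by linarith))] with n hn
      exact hn.2 y (htB hy).1 hyr.le
    filter_upwards [hev, h r (min (ε / 2) η) (lt_min (half_pos hε) hη)] with n hn1 hn2
    refine Metric.hausdorffEDist_le_of_mem_edist ?_ ?_
    · rintro a ⟨ha, har⟩
      obtain ⟨b, hb, hab⟩ := hn2.1 a ha har
      have har' : dist a ρ ≤ r := har
      -- The partner `b` may fall slightly outside the ball; it is pulled back to a point `b'` of
      -- `B` inside it.
      obtain ⟨b', hb', hbr, hbb⟩ := hηB b hb (by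
        linarith [dist_triangle_left b ρ a, min_le_right (ε / 2) η])
      refine ⟨b', ⟨hb', hbr⟩, ?_⟩
      rw [edist_dist]
      exact ENNReal.ofReal_le_ofReal
        (by linarith [dist_triangle a b b', min_le_left (ε / 2) η])
    · intro b hb
      obtain ⟨y, hy, hby⟩ := Set.mem_iUnion₂.1 (hcov hb)
      obtain ⟨a, ha, hya⟩ := hn1 y hy
      have hby' : dist b y < ε / 2 := hby
      have h1 := min_le_left (ε / 2) (r - dist y ρ)
      have h2 := min_le_right (ε / 2) (r - dist y ρ)
      refine ⟨a, ⟨ha, Metric.mem_closedBall.2 ?_⟩, ?_⟩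
      · linarith [dist_triangle_left a ρ y]
      · rw [edist_dist]
        exact ENNReal.ofReal_le_ofReal (by linarith [dist_triangle b y a])
  refine ENNReal.tendsto_nhds_zero.2 fun ε hε => ?_
  rcases eq_or_ne ε ⊤ with rfl | hε'
  · simp
  · filter_upwards [key ε.toReal (ENNReal.toReal_pos hε.ne' hε')] with n hn
    rwa [ENNReal.ofReal_toReal hε'] at hn

theorem fellTendsto_of_locallyClose {Z : Type u} [MetricSpace Z] [ProperSpace Z]
    {A : ℕ → Set Z} {B : Set Z} (hB : IsClosed B) (ρ : Z)
    (h : ∀ R δ : ℝ, 0 < δ → ∀ᶠ n in atTop, LocallyClose ρ R δ (A n) B) : FellTendsto A B := by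
  intro ρ'
  refine tendsto_localize ?_
  filter_upwards [(countable_setOf_notMem_closure_inter_ball ρ' B).ae_notMem volume] with r hr
  refine tendsto_hausdorffEDist_inter_closedBall hB (fun R δ hδ => ?_) ?_
  · exact (h (R + dist ρ' ρ) δ hδ).mono fun n hn => hn.mono le_rfl le_rfl
  · intro b hb hbr
    by_contra hbc
    exact hr ⟨b, hb, hbr, hbc⟩

/-! ### Lipschitz test functions -/

/-- At distances at most `1`, `d ≤ d ^ κ` turns the Lipschitz bound into a Hölder bound; beyond `1`
the oscillation `2 * C` is at most `2 * C * d ^ κ`. The norm is thus at most `C + (2 * C + L)`, and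
the extra `1` in `K` only keeps `K` positive. -/
theorem blNorm_le_one_of_lipschitz {Z : Type u} [MetricSpace Z] {κ : ℝ} (hκ₀ : 0 < κ)
    (hκ₁ : κ ≤ 1) {ψ : Z → ℝ} {L C K : ℝ} (hψ : ∀ x y, |ψ x - ψ y| ≤ L * dist x y)
    (hC : ∀ z, |ψ z| ≤ C) (hL₀ : 0 ≤ L) (hC₀ : 0 ≤ C) (hK : 3 * C + L + 1 ≤ K) :
    blNorm κ (fun z => K⁻¹ * ψ z) ≤ 1 := by
  have hK0 : 0 < K := by linarith
  have h1 : ∀ z, |K⁻¹ * ψ z| ≤ C / K := fun z => by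
    rw [abs_mul, abs_of_pos (inv_pos.2 hK0), inv_mul_eq_div]
    gcongr
    exact hC z
  have h2 : ∀ x y, |K⁻¹ * ψ x - K⁻¹ * ψ y| ≤ (2 * C + L) / K * dist x y ^ κ := fun x y => by
    rw [← mul_sub, abs_mul, abs_of_pos (inv_pos.2 hK0), inv_mul_eq_div, div_mul_eq_mul_div]
    gcongr
    have hpow : 0 ≤ dist x y ^ κ := by positivity
    rcases le_total (dist x y) 1 with hle | hge
    · have : dist x y ≤ dist x y ^ κ := by
        simpa using Real.rpow_le_rpow_of_exponent_ge_of_imp dist_nonneg hle hκ₁ (fun _ h => by linarith)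
      nlinarith [hψ x y, mul_le_mul_of_nonneg_left this hL₀, mul_nonneg hC₀ hpow]
    · have : 1 ≤ dist x y ^ κ := Real.one_le_rpow hge hκ₀.le
      have h3 : |ψ x - ψ y| ≤ |ψ x| + |ψ y| := abs_sub _ _
      nlinarith [hC x, hC y, mul_nonneg hL₀ hpow]
  have hsum : ENNReal.ofReal (C / K) + ENNReal.ofReal ((2 * C + L) / K) ≤ 1 := by
    rw [← ENNReal.ofReal_add (by positivity) (by positivity), ENNReal.ofReal_le_one, ← add_div,
      div_le_one hK0]
    linarith
  refine le_trans (add_le_add (iSup_le fun z => ?_) (iSup_le fun x => iSup_le fun y =>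
    iSup_le fun hxy => ?_)) hsum
  · rw [Real.enorm_eq_ofReal_abs]
    exact ENNReal.ofReal_le_ofReal (h1 z)
  · refine ENNReal.div_le_of_le_mul ?_
    rw [Real.enorm_eq_ofReal_abs, edist_dist, ENNReal.ofReal_rpow_of_nonneg dist_nonneg hκ₀.le,
      ← ENNReal.ofReal_mul (by positivity)]
    exact ENNReal.ofReal_le_ofReal (h2 x y)

theorem enorm_integral_sub_le_blDist {Z : Type u} [MetricSpace Z] [MeasurableSpace Z] {κ : ℝ}
    (hκ₀ : 0 < κ) (hκ₁ : κ ≤ 1) {ψ : Z → ℝ} {L C : ℝ}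
    (hψ : ∀ x y, |ψ x - ψ y| ≤ L * dist x y) (hC : ∀ z, |ψ z| ≤ C) (hL₀ : 0 ≤ L) (hC₀ : 0 ≤ C)
    (μ ν : Measure Z) :
    ‖∫ z, ψ z ∂μ - ∫ z, ψ z ∂ν‖ₑ ≤ ENNReal.ofReal (3 * C + L + 1) * blDist κ μ ν := by
  set K := 3 * C + L + 1 with hK
  have hK0 : 0 < K := by positivity
  have key : ‖∫ z, K⁻¹ * ψ z ∂μ - ∫ z, K⁻¹ * ψ z ∂ν‖ₑ ≤ blDist κ μ ν :=
    le_iSup₂ (f := fun (f : Z → ℝ) (_ : blNorm κ f ≤ 1) => ‖∫ z, f z ∂μ - ∫ z, f z ∂ν‖ₑ)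
      (fun z => K⁻¹ * ψ z) (blNorm_le_one_of_lipschitz hκ₀ hκ₁ hψ hC hL₀ hC₀ hK.ge)
  calc ‖∫ z, ψ z ∂μ - ∫ z, ψ z ∂ν‖ₑ
      = ENNReal.ofReal K * ‖∫ z, K⁻¹ * ψ z ∂μ - ∫ z, K⁻¹ * ψ z ∂ν‖ₑ := by
        rw [integral_const_mul, integral_const_mul, ← mul_sub, enorm_mul, ← mul_assoc,
          Real.enorm_eq_ofReal (inv_pos.2 hK0).le, ← ENNReal.ofReal_mul hK0.le,
          mul_inv_cancel₀ hK0.ne', ENNReal.ofReal_one, one_mul]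
    _ ≤ _ := by gcongr

theorem setIntegral_closedBall_eq_integral {Z : Type u} [MetricSpace Z] [MeasurableSpace Z]
    {ρ : Z} {R r : ℝ} (hRr : R ≤ r) {ψ : Z → ℝ} (hψ : ∀ z, R < dist z ρ → ψ z = 0)
    (μ : Measure Z) : ∫ z in Metric.closedBall ρ r, ψ z ∂μ = ∫ z, ψ z ∂μ :=
  setIntegral_eq_integral_of_forall_compl_eq_zero fun z hz => hψ z (by
    rw [Metric.mem_closedBall] at hz; linarith [not_le.1 hz])

theorem abs_integral_sub_le_of_rootedBLDist_lt {Z : Type u} [MetricSpace Z] [MeasurableSpace Z]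
    {κ : ℝ} (hκ₀ : 0 < κ) (hκ₁ : κ ≤ 1) {ρ : Z} {R δ : ℝ} (hR : 0 ≤ R) (hδ₀ : 0 ≤ δ) (hδ₁ : δ ≤ 1)
    {μ ν : Measure Z}
    (h : rootedBLDist κ ρ μ ν < ENNReal.ofReal (Real.exp (-(R + 1))) * ENNReal.ofReal δ)
    {ψ : Z → ℝ} {L C : ℝ} (hψ : ∀ x y, |ψ x - ψ y| ≤ L * dist x y) (hC : ∀ z, |ψ z| ≤ C)
    (hL₀ : 0 ≤ L) (hC₀ : 0 ≤ C) (hsupp : ∀ z, R < dist z ρ → ψ z = 0) :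
    |∫ z, ψ z ∂μ - ∫ z, ψ z ∂ν| ≤ (3 * C + L + 1) * δ := by
  obtain ⟨r, hRr, -, hr⟩ := exists_lt_of_localize_lt hR (by simpa using hδ₁) h
  have := enorm_integral_sub_le_blDist hκ₀ hκ₁ hψ hC hL₀ hC₀
    (μ.restrict (Metric.closedBall ρ r)) (ν.restrict (Metric.closedBall ρ r))
  rw [setIntegral_closedBall_eq_integral hRr hsupp, setIntegral_closedBall_eq_integral hRr hsupp,
    Real.enorm_eq_ofReal_abs] at this
  have h2 := this.trans (mul_le_mul_right hr.le _)
  rw [← ENNReal.ofReal_mul (by positivity)] at h2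
  exact (ENNReal.ofReal_le_ofReal_iff (by positivity)).1 h2

/-- Layer-cake formula: the `δ`-thickening of `{t ≤ ψ}` lies in `{t ≤ ψ + L * δ}`. The shift costs
`L * δ` times the mass of `ν`, and the additive `δ` at each level up to the supremum costs at most
`δ * C`. -/
theorem integral_le_add_of_levyProkhorovEDist_lt {Z : Type u} [MetricSpace Z] [MeasurableSpace Z]
    [BorelSpace Z] {δ : ℝ} (hδ₀ : 0 < δ) {μ ν : Measure Z} [IsFiniteMeasure μ]
    [IsFiniteMeasure ν] (h : levyProkhorovEDist μ ν < ENNReal.ofReal δ) {ψ : Z → ℝ} {L C : ℝ}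
    (hψ : ∀ x y, |ψ x - ψ y| ≤ L * dist x y) (hψ₀ : ∀ z, 0 ≤ ψ z) (hC : ∀ z, ψ z ≤ C)
    (hL₀ : 0 ≤ L) (hC₀ : 0 ≤ C) :
    ∫ z, ψ z ∂μ ≤ ∫ z, ψ z ∂ν + δ * (L * ν.real Set.univ + C) := by
  have hcont : Continuous ψ := (LipschitzWith.of_dist_le_mul (K := L.toNNReal) fun x y => by
    rw [Real.coe_toNNReal _ hL₀, Real.dist_eq]; exact hψ x y).continuous
  let f : BoundedContinuousFunction Z ℝ := BoundedContinuousFunction.ofNormedAddCommGroup ψ hcont C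
    fun z => by rw [Real.norm_eq_abs, abs_of_nonneg (hψ₀ z)]; exact hC z
  let g : BoundedContinuousFunction Z ℝ := f + BoundedContinuousFunction.const Z (L * δ)
  have hf : ∀ z, f z = ψ z := fun z => rfl
  have hg : ∀ z, g z = ψ z + L * δ := fun z => rfl
  have hLδ : 0 ≤ L * δ := by positivity
  have hfC : ‖f‖ ≤ C := BoundedContinuousFunction.norm_ofNormedAddCommGroup_le _ hC₀ _
  have hfg : ‖f‖ ≤ ‖g‖ := by
    refine (BoundedContinuousFunction.norm_le (norm_nonneg _)).2 fun z => ?_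
    refine le_trans ?_ (g.norm_coe_le_norm z)
    rw [hf, hg, Real.norm_eq_abs, Real.norm_eq_abs, abs_of_nonneg (hψ₀ z),
      abs_of_nonneg (by linarith [hψ₀ z])]
    linarith
  have key := BoundedContinuousFunction.integral_le_of_levyProkhorovEDist_lt μ ν hδ₀ h f
    (Eventually.of_forall hψ₀)
  have hanti : Antitone fun t : ℝ => ν.real {a | t ≤ g a} := fun s t hst =>
    measureReal_mono fun a (ha : t ≤ g a) => hst.trans ha
  have h2 : ∫ t in Set.Ioc 0 ‖f‖, ν.real (Metric.thickening δ {a | t ≤ f a}) ≤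
      ∫ t in Set.Ioc 0 ‖g‖, ν.real {a | t ≤ g a} := by
    have hint : IntegrableOn (fun t : ℝ => ν.real {a | t ≤ g a}) (Set.Ioc 0 ‖g‖) :=
      ((hanti.antitoneOn _).integrableOn_isCompact isCompact_Icc).mono_set Set.Ioc_subset_Icc_self
    have hsub : Set.Ioc 0 ‖f‖ ⊆ Set.Ioc 0 ‖g‖ := Set.Ioc_subset_Ioc_right hfg
    refine le_trans (integral_mono_of_nonneg (Eventually.of_forall fun t => measureReal_nonneg)
      (hint.mono_set hsub) (Eventually.of_forall fun t => ?_))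
      (setIntegral_mono_set hint (Eventually.of_forall fun t => measureReal_nonneg)
        hsub.eventuallyLE)
    refine measureReal_mono fun a ha => ?_
    obtain ⟨b, hb, hab⟩ := Metric.mem_thickening_iff.1 ha
    have hb' : t ≤ ψ b := hb
    have h3 := hψ b a
    rw [dist_comm] at h3
    show t ≤ ψ a + L * δ
    linarith [le_abs_self (ψ b - ψ a), mul_le_mul_of_nonneg_left hab.le hL₀]
  rw [← BoundedContinuousFunction.integral_eq_integral_meas_le g ν
    (Eventually.of_forall fun z => by rw [hg]; simpa using add_nonneg (hψ₀ z) hLδ)] at h2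
  have h4 : ∫ z, g z ∂ν = ∫ z, ψ z ∂ν + L * δ * ν.real Set.univ := by
    have : ∫ z, g z ∂ν = ∫ z, (f z + L * δ) ∂ν := rfl
    rw [this, integral_add (f.integrable ν) (integrable_const _)]
    simp [hf, mul_comm]
  have h5 : ∫ z, f z ∂μ = ∫ z, ψ z ∂μ := rfl
  nlinarith [mul_le_mul_of_nonneg_left hfC hδ₀.le]

/-- A mass bound is assumed for `ν` alone, so that the constant depends only on the limit when `ν`
is the limit measure. The Prokhorov bound itself gives `μ` mass at most `m + δ ≤ m + 1` on the
chosen ball. -/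
theorem abs_integral_sub_le_of_rootedProkhorovDist_lt {Z : Type u} [MetricSpace Z]
    [ProperSpace Z] [MeasurableSpace Z] [BorelSpace Z] {ρ : Z} {R δ m : ℝ} (hR : 0 ≤ R)
    (hδ₀ : 0 < δ) (hδ₁ : δ ≤ 1) {μ ν : Measure Z} [IsFiniteMeasureOnCompacts μ]
    [IsFiniteMeasureOnCompacts ν] (hm : ν.real (Metric.closedBall ρ (R + 1)) ≤ m)
    (h : rootedProkhorovDist ρ μ ν < ENNReal.ofReal (Real.exp (-(R + 1))) * ENNReal.ofReal δ)
    {ψ : Z → ℝ} {L C : ℝ} (hψ : ∀ x y, |ψ x - ψ y| ≤ L * dist x y) (hψ₀ : ∀ z, 0 ≤ ψ z)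
    (hC : ∀ z, ψ z ≤ C) (hL₀ : 0 ≤ L) (hC₀ : 0 ≤ C) (hsupp : ∀ z, R < dist z ρ → ψ z = 0) :
    |∫ z, ψ z ∂μ - ∫ z, ψ z ∂ν| ≤ (L * (m + 1) + C) * δ := by
  obtain ⟨r, hRr, hrR, hr⟩ := exists_lt_of_localize_lt hR (by simpa using hδ₁) h
  have hfin : ∀ ξ : Measure Z, IsFiniteMeasureOnCompacts ξ →
      IsFiniteMeasure (ξ.restrict (Metric.closedBall ρ r)) := fun ξ _ =>
    isFiniteMeasure_restrict.2 (isCompact_closedBall ρ r).measure_lt_top.ne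
  have := hfin μ inferInstance
  have := hfin ν inferInstance
  have hν : (ν.restrict (Metric.closedBall ρ r)).real Set.univ ≤ m := by
    rw [measureReal_restrict_apply MeasurableSet.univ, Set.univ_inter]
    exact (measureReal_mono (Metric.closedBall_subset_closedBall hrR)
      (isCompact_closedBall ρ (R + 1)).measure_lt_top.ne).trans hm
  have hμ : (μ.restrict (Metric.closedBall ρ r)).real Set.univ ≤ m + 1 := by
    have := left_measure_le_of_levyProkhorovEDist_lt hr MeasurableSet.univ
    have h2 := ENNReal.toReal_mono (by finiteness) (this.trans
      (add_le_add (measure_mono (Set.subset_univ _)) le_rfl))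
    rw [ENNReal.toReal_add (by finiteness) (by finiteness), ENNReal.toReal_ofReal hδ₀.le] at h2
    change (μ.restrict (Metric.closedBall ρ r)).real Set.univ ≤
      (ν.restrict (Metric.closedBall ρ r)).real Set.univ + δ at h2
    linarith
  have h1 := integral_le_add_of_levyProkhorovEDist_lt hδ₀ hr hψ hψ₀ hC hL₀ hC₀
  rw [levyProkhorovEDist_comm] at hr
  have h2 := integral_le_add_of_levyProkhorovEDist_lt hδ₀ hr hψ hψ₀ hC hL₀ hC₀
  rw [setIntegral_closedBall_eq_integral hRr hsupp, setIntegral_closedBall_eq_integral hRr hsupp]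
    at h1 h2
  have h3 : δ * (L * (μ.restrict (Metric.closedBall ρ r)).real Set.univ + C) ≤
    δ * (L * (m + 1) + C) := by gcongr
  have h4 : δ * (L * (ν.restrict (Metric.closedBall ρ r)).real Set.univ + C) ≤
    δ * (L * (m + 1) + C) := by gcongr; linarith
  rw [abs_le]
  constructor <;> linarith

/-! ### Vague convergence and convergence of the rooted distances -/

theorem abs_le_one_of_blNorm_le_one {Z : Type u} [MetricSpace Z] {κ : ℝ} {f : Z → ℝ}
    (hf : blNorm κ f ≤ 1) (z : Z) : |f z| ≤ 1 := by
  have h := (le_iSup (fun z => ‖f z‖ₑ) z).trans (le_self_add.trans hf)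
  rwa [Real.enorm_eq_ofReal_abs, ENNReal.ofReal_le_one] at h

theorem abs_sub_le_of_blNorm_le_one {Z : Type u} [MetricSpace Z] {κ : ℝ} (hκ : 0 < κ)
    {f : Z → ℝ} (hf : blNorm κ f ≤ 1) (x y : Z) : |f x - f y| ≤ dist x y ^ κ := by
  rcases eq_or_ne x y with rfl | hxy
  · simpa using Real.rpow_nonneg le_rfl κ
  have h := ((le_iSup (fun _ : x ≠ y => ‖f x - f y‖ₑ / edist x y ^ κ) hxy).trans
    ((le_iSup (fun y => ⨆ (_ : x ≠ y), ‖f x - f y‖ₑ / edist x y ^ κ) y).trans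
      (le_iSup (fun x => ⨆ (y) (_ : x ≠ y), ‖f x - f y‖ₑ / edist x y ^ κ) x))).trans
        (le_add_self.trans hf)
  have hpos : 0 < dist x y ^ κ := Real.rpow_pos_of_pos (dist_pos.2 hxy) κ
  rw [edist_dist, ENNReal.ofReal_rpow_of_nonneg dist_nonneg hκ.le, Real.enorm_eq_ofReal_abs,
    ENNReal.div_le_iff (by simpa using hpos) ENNReal.ofReal_ne_top, one_mul] at h
  exact (ENNReal.ofReal_le_ofReal_iff hpos.le).1 h

theorem continuous_of_blNorm_le_one {Z : Type u} [MetricSpace Z] {κ : ℝ} (hκ : 0 < κ)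
    {f : Z → ℝ} (hf : blNorm κ f ≤ 1) : Continuous f := by
  refine continuous_iff_continuousAt.2 fun x => tendsto_iff_dist_tendsto_zero.2 ?_
  have h : Tendsto (fun y => dist y x ^ κ) (𝓝 x) (𝓝 0) := by
    have : Tendsto (fun y => dist y x) (𝓝 x) (𝓝 0) := tendsto_iff_dist_tendsto_zero.1 tendsto_id
    simpa [Real.zero_rpow hκ.ne'] using this.rpow_const (Or.inr hκ.le)
  exact squeeze_zero (fun _ => dist_nonneg) (fun y => abs_sub_le_of_blNorm_le_one hκ hf y x) h

theorem hasCompactSupport_of_dist {Z : Type u} [MetricSpace Z] [ProperSpace Z] {f : Z → ℝ}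
    {ρ : Z} {R : ℝ} (hf : ∀ z, R < dist z ρ → f z = 0) : HasCompactSupport f :=
  HasCompactSupport.intro (isCompact_closedBall ρ R) fun z hz => hf z (by simpa using hz)

section
variable {Z : Type u} [MetricSpace Z] [ProperSpace Z] [MeasurableSpace Z] [BorelSpace Z]

theorem Continuous.integrable_of_dist {μ : Measure Z} [IsFiniteMeasureOnCompacts μ]
    {f : Z → ℝ} (hc : Continuous f) {ρ : Z} {R : ℝ} (hf : ∀ z, R < dist z ρ → f z = 0) :
    Integrable f μ :=
  hc.integrable_of_hasCompactSupport (hasCompactSupport_of_dist hf)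

theorem measureReal_closedBall_le_integral {μ : Measure Z} [IsFiniteMeasureOnCompacts μ]
    (ρ : Z) (R : ℝ) :
    μ.real (Metric.closedBall ρ R) ≤ ∫ z, max 0 (R + 1 - dist z ρ) ∂μ := by
  have hi : Integrable (fun z => max 0 (R + 1 - dist z ρ)) μ :=
    Continuous.integrable_of_dist (by fun_prop) (ρ := ρ) (R := R + 1)
      fun z hz => max_eq_left (by linarith)
  rw [← integral_indicator_one Metric.isClosed_closedBall.measurableSet]
  refine integral_mono ((integrable_indicator_iff Metric.isClosed_closedBall.measurableSet).2
    (integrableOn_const (isCompact_closedBall ρ R).measure_lt_top.ne)) hi fun z => ?_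
  refine Set.indicator_le' (g := fun z => max 0 (R + 1 - dist z ρ)) (fun a ha => ?_)
    (fun a _ => le_max_left _ _) z
  have : dist a ρ ≤ R := ha
  exact le_max_of_le_right (by simp; linarith)

theorem eventually_measureReal_closedBall_le {μs : ℕ → Measure Z} {μ : Measure Z}
    [∀ n, IsFiniteMeasureOnCompacts (μs n)] (ρ : Z) (R : ℝ)
    (h : Tendsto (fun n => ∫ z, max 0 (R + 1 - dist z ρ) ∂(μs n)) atTop
      (𝓝 (∫ z, max 0 (R + 1 - dist z ρ) ∂μ))) :
    ∃ m : ℝ, 0 < m ∧ ∀ᶠ n in atTop, (μs n).real (Metric.closedBall ρ R) ≤ m := by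
  refine ⟨∫ z, max 0 (R + 1 - dist z ρ) ∂μ + 1, ?_, ?_⟩
  · have : 0 ≤ ∫ z, max 0 (R + 1 - dist z ρ) ∂μ := integral_nonneg fun z => le_max_left _ _
    linarith
  · filter_upwards [h.eventually (gt_mem_nhds (lt_add_one _))] with n hn
    exact (measureReal_closedBall_le_integral ρ R).trans hn.le

theorem VagueTendsto.eventually_measureReal_closedBall_le {μs : ℕ → Measure Z} {μ : Measure Z}
    [∀ n, IsFiniteMeasureOnCompacts (μs n)] (h : VagueTendsto μs μ) (ρ : Z) (R : ℝ) :
    ∃ m : ℝ, 0 < m ∧ ∀ᶠ n in atTop, (μs n).real (Metric.closedBall ρ R) ≤ m :=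
  _root_.eventually_measureReal_closedBall_le ρ R
    (h _ (by fun_prop) (hasCompactSupport_of_dist (ρ := ρ) (R := R + 1)
      fun z hz => max_eq_left (by linarith)))

/-- As `k` grows the tents decrease to the indicator of a null sphere, dominated by the tent with `k
= 1`. -/
theorem exists_integral_tent_lt {μ : Measure Z} [IsFiniteMeasureOnCompacts μ] {ρ : Z} {r : ℝ}
    (hr : μ (Metric.sphere ρ r) = 0) {ε : ℝ} (hε : 0 < ε) :
    ∃ k : ℕ, ∫ z, max 0 (1 - k * |dist z ρ - r|) ∂μ < ε ∧ 1 ≤ k := by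
  have hlim : Tendsto (fun k : ℕ => ∫ z, max 0 (1 - (k : ℝ) * |dist z ρ - r|) ∂μ) atTop
      (𝓝 (∫ _, (0 : ℝ) ∂μ)) := by
    refine tendsto_integral_filter_of_dominated_convergence
      (fun z => max 0 (1 - |dist z ρ - r|)) ?_ ?_ ?_ ?_
    · exact Eventually.of_forall fun k => Continuous.aestronglyMeasurable (by fun_prop)
    · filter_upwards [eventually_ge_atTop 1] with k hk
      refine Eventually.of_forall fun z => ?_
      rw [Real.norm_of_nonneg (le_max_left _ _)]
      have : (1 : ℝ) ≤ k := by exact_mod_cast hk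
      have := mul_le_mul_of_nonneg_right this (abs_nonneg (dist z ρ - r))
      exact max_le_max le_rfl (by linarith)
    · refine Continuous.integrable_of_dist (by fun_prop) (ρ := ρ) (R := r + 1) fun z hz => ?_
      exact max_eq_left (by linarith [le_abs_self (dist z ρ - r)])
    · have : ∀ᵐ z ∂μ, z ∉ Metric.sphere ρ r := measure_eq_zero_iff_ae_notMem.1 hr
      filter_upwards [this] with z hz
      have hpos : 0 < |dist z ρ - r| := abs_pos.2 fun h => hz (by
        rw [Metric.mem_sphere]; linarith)
      refine tendsto_const_nhds.congr' ?_
      filter_upwards [(tendsto_natCast_atTop_atTop.atTop_mul_const hpos).eventually_ge_atTop 1]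
        with k hk
      exact (max_eq_left (by linarith)).symm
  rw [integral_zero] at hlim
  obtain ⟨k, hk1, hk2⟩ := ((hlim.eventually (gt_mem_nhds hε)).and (eventually_ge_atTop 1)).exists
  exact ⟨k, hk1, hk2⟩

theorem VagueTendsto.tendsto_setIntegral_closedBall {μs : ℕ → Measure Z} {μ : Measure Z}
    [∀ n, IsFiniteMeasureOnCompacts (μs n)] [IsFiniteMeasureOnCompacts μ]
    (h : VagueTendsto μs μ) {ρ : Z} {r : ℝ} (hr : μ (Metric.sphere ρ r) = 0) {f : Z → ℝ}
    (hf : Continuous f) :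
    Tendsto (fun n => ∫ z in Metric.closedBall ρ r, f z ∂(μs n)) atTop
      (𝓝 (∫ z in Metric.closedBall ρ r, f z ∂μ)) := by
  obtain ⟨C, hC⟩ := (isCompact_closedBall ρ r).exists_bound_of_continuousOn hf.continuousOn
  refine Metric.tendsto_nhds.2 fun ε hε => ?_
  have hC1 : 0 < |C| + 1 := by positivity
  obtain ⟨k, hkε, hk1⟩ := exists_integral_tent_lt hr (ε := ε / 4 / (|C| + 1)) (by positivity)
  have hk0 : (1 : ℝ) ≤ k := by exact_mod_cast hk1
  -- The indicator of the ball is replaced by a continuous cutoff inside `χ`. On the ball the error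
  -- is exactly `f * β`, and vague convergence controls the integrals of both `χ` and `β`.
  set β : Z → ℝ := fun z => max 0 (1 - k * |dist z ρ - r|) with hβ
  set χ : Z → ℝ := fun z => f z * max 0 (min 1 (k * (r - dist z ρ))) with hχ
  have hβc : Continuous β := by fun_prop
  have hχc : Continuous χ := by fun_prop
  have hβs : ∀ z, r + 1 < dist z ρ → β z = 0 := fun z hz => max_eq_left (by
    have := le_abs_self (dist z ρ - r)
    nlinarith)
  have hχs : ∀ z, r < dist z ρ → χ z = 0 := fun z hz => by
    have : (k : ℝ) * (r - dist z ρ) ≤ 0 := mul_nonpos_of_nonneg_of_nonpos (by linarith) (by linarith)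
    simp only [hχ]
    rw [max_eq_left ((min_le_right _ _).trans this), mul_zero]
  have hβ0 : ∀ z, 0 ≤ β z := fun z => le_max_left _ _
  have key : ∀ ξ : Measure Z, IsFiniteMeasureOnCompacts ξ →
      |∫ z in Metric.closedBall ρ r, f z ∂ξ - ∫ z, χ z ∂ξ| ≤ (|C| + 1) * ∫ z, β z ∂ξ := by
    intro ξ _
    have hβi : Integrable β ξ := hβc.integrable_of_dist hβs
    rw [← setIntegral_closedBall_eq_integral le_rfl hχs, ← integral_sub
      (hf.continuousOn.integrableOn_compact (isCompact_closedBall ρ r))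
      (hχc.integrable_of_dist hχs).integrableOn, ← integral_const_mul]
    refine (abs_integral_le_integral_abs).trans ?_
    refine le_trans (setIntegral_mono_on
      ((hf.sub hχc).abs.continuousOn.integrableOn_compact (isCompact_closedBall ρ r))
      (hβi.const_mul (|C| + 1)).integrableOn Metric.isClosed_closedBall.measurableSet ?_)
      (setIntegral_le_integral (hβi.const_mul _) (Eventually.of_forall fun z => ?_))
    · intro z hz
      have hz' : dist z ρ ≤ r := hz
      have e : f z - χ z = f z * β z := by
        simp only [hχ, hβ, abs_of_nonpos (sub_nonpos.2 hz')]
        have h0 : 0 ≤ (k : ℝ) * (r - dist z ρ) := mul_nonneg (by linarith) (by linarith)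
        rcases le_total 1 ((k : ℝ) * (r - dist z ρ)) with h1 | h1
        · rw [min_eq_left h1, max_eq_right zero_le_one, max_eq_left (by linarith)]
          ring
        · rw [min_eq_right h1, max_eq_right h0, max_eq_right (by linarith)]
          ring
      have hfz : |f z| ≤ |C| + 1 := by
        have := hC z hz
        rw [Real.norm_eq_abs] at this
        linarith [le_abs_self C]
      show |f z - χ z| ≤ (|C| + 1) * β z
      rw [e, abs_mul, abs_of_nonneg (hβ0 z)]
      exact mul_le_mul_of_nonneg_right hfz (hβ0 z)
    · exact mul_nonneg hC1.le (hβ0 z)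
  have hχt := h χ hχc (hasCompactSupport_of_dist hχs)
  have hβt := h β hβc (hasCompactSupport_of_dist hβs)
  have hkε' : (|C| + 1) * ∫ z, β z ∂μ < ε / 4 := by
    rw [lt_div_iff₀ hC1] at hkε
    linarith
  filter_upwards [(hβt.const_mul (|C| + 1)).eventually (gt_mem_nhds hkε'),
    hχt.eventually (Metric.ball_mem_nhds _ (half_pos (half_pos hε)))] with n hn1 hn2
  have h1 := key (μs n) inferInstance
  have h2 := key μ inferInstance
  rw [Real.dist_eq] at hn2 ⊢
  rw [abs_lt] at *
  rw [abs_le] at h1 h2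
  constructor <;> linarith
end

/-- Functions of norm at most `1` are bounded by `1` and share the modulus of continuity `x ^ κ`, so
by Arzelà–Ascoli their restrictions to the compact ball are totally bounded. -/
theorem exists_finite_blNorm_net {Z : Type u} [MetricSpace Z] [ProperSpace Z] {κ : ℝ}
    (hκ : 0 < κ) (ρ : Z) (r : ℝ) {ε : ℝ} (hε : 0 < ε) :
    ∃ t : Set (Z → ℝ), t.Finite ∧ (∀ g ∈ t, blNorm κ g ≤ 1) ∧
      ∀ f, blNorm κ f ≤ 1 → ∃ g ∈ t, ∀ z ∈ Metric.closedBall ρ r, |f z - g z| ≤ ε := by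
  have : CompactSpace (Metric.closedBall ρ r) :=
    isCompact_iff_compactSpace.1 (isCompact_closedBall ρ r)
  let A : Set (BoundedContinuousFunction (Metric.closedBall ρ r) ℝ) :=
    {F | ∃ f : Z → ℝ, blNorm κ f ≤ 1 ∧ ∀ z : Metric.closedBall ρ r, F z = f z}
  have hA : IsCompact (closure A) := by
    refine BoundedContinuousFunction.arzela_ascoli (Set.Icc (-1) 1) isCompact_Icc A ?_ ?_
    · rintro F z ⟨f, hf, hFf⟩
      rw [hFf, Set.mem_Icc, ← abs_le]
      exact abs_le_one_of_blNorm_le_one hf z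
    · refine Metric.equicontinuous_of_continuity_modulus (fun x => x ^ κ) ?_ _ ?_
      · simpa [Real.zero_rpow hκ.ne'] using
          (tendsto_id (x := 𝓝 (0 : ℝ))).rpow_const (p := κ) (Or.inr hκ.le)
      · rintro x y ⟨F, f, hf, hFf⟩
        simp only [hFf, Real.dist_eq]
        exact abs_sub_le_of_blNorm_le_one hκ hf x y
  obtain ⟨t, htA, htf, hcov⟩ :=
    Metric.finite_approx_of_totallyBounded (hA.totallyBounded.subset subset_closure) ε hε
  choose! e he1 he2 using fun F (hF : F ∈ A) => hF
  refine ⟨e '' t, htf.image e, ?_, fun f hf => ?_⟩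
  · rintro _ ⟨F, hF, rfl⟩
    exact he1 F (htA hF)
  · let F : BoundedContinuousFunction (Metric.closedBall ρ r) ℝ :=
      BoundedContinuousFunction.mkOfCompact
        ⟨fun z => f z, (continuous_of_blNorm_le_one hκ hf).comp continuous_subtype_val⟩
    obtain ⟨G, hG, hFG⟩ := Set.mem_iUnion₂.1 (hcov (show F ∈ A from ⟨f, hf, fun z => rfl⟩))
    refine ⟨e G, Set.mem_image_of_mem e hG, fun z hz => ?_⟩
    have h1 := (BoundedContinuousFunction.dist_coe_le_dist (f := F) (g := G) ⟨z, hz⟩).trans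
      (Metric.mem_ball.1 hFG).le
    rw [Real.dist_eq, he2 G (htA hG)] at h1
    exact h1

section
variable {Z : Type u} [MetricSpace Z] [ProperSpace Z] [MeasurableSpace Z] [BorelSpace Z]

theorem abs_setIntegral_sub_le_of_forall_abs_sub_le {ξ : Measure Z}
    [IsFiniteMeasureOnCompacts ξ] {ρ : Z} {r ε m : ℝ} (hm : ξ.real (Metric.closedBall ρ r) ≤ m)
    (hε : 0 ≤ ε) {f g : Z → ℝ} (hf : Continuous f) (hg : Continuous g)
    (hfg : ∀ z ∈ Metric.closedBall ρ r, |f z - g z| ≤ ε) :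
    |∫ z in Metric.closedBall ρ r, f z ∂ξ - ∫ z in Metric.closedBall ρ r, g z ∂ξ| ≤ ε * m := by
  rw [← integral_sub (hf.continuousOn.integrableOn_compact (isCompact_closedBall ρ r))
    (hg.continuousOn.integrableOn_compact (isCompact_closedBall ρ r))]
  rw [← Real.norm_eq_abs]
  exact (norm_setIntegral_le_of_norm_le_const (isCompact_closedBall ρ r).measure_lt_top hfg).trans
    (mul_le_mul_of_nonneg_left hm hε)

theorem VagueTendsto.tendsto_blDist_restrict {κ : ℝ} (hκ : 0 < κ) {μs : ℕ → Measure Z}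
    {μ : Measure Z} [∀ n, IsFiniteMeasureOnCompacts (μs n)] [IsFiniteMeasureOnCompacts μ]
    (h : VagueTendsto μs μ) {ρ : Z} {r : ℝ} (hr : μ (Metric.sphere ρ r) = 0) :
    Tendsto (fun n => blDist κ ((μs n).restrict (Metric.closedBall ρ r))
      (μ.restrict (Metric.closedBall ρ r))) atTop (𝓝 0) := by
  obtain ⟨m, hm0, hm⟩ := h.eventually_measureReal_closedBall_le ρ r
  set M := max m (μ.real (Metric.closedBall ρ r)) with hM
  have hM0 : 0 < M := lt_max_of_lt_left hm0
  have key : ∀ ε : ℝ, 0 < ε → ∀ᶠ n in atTop,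
      blDist κ ((μs n).restrict (Metric.closedBall ρ r))
        (μ.restrict (Metric.closedBall ρ r)) ≤ ENNReal.ofReal ε := by
    intro ε hε
    obtain ⟨t, htf, ht1, htn⟩ := exists_finite_blNorm_net hκ ρ r (ε := ε / 3 / M) (by positivity)
    have hev : ∀ᶠ n in atTop, ∀ g ∈ t, |∫ z in Metric.closedBall ρ r, g z ∂(μs n) -
        ∫ z in Metric.closedBall ρ r, g z ∂μ| < ε / 3 :=
      htf.eventually_all.2 fun g hg => Metric.tendsto_nhds.1 (h.tendsto_setIntegral_closedBall hr
        (continuous_of_blNorm_le_one hκ (ht1 g hg))) _ (by positivity)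
    filter_upwards [hev, hm] with n hn hmn
    refine iSup₂_le fun f hf => ?_
    obtain ⟨g, hg, hfg⟩ := htn f hf
    have hfc := continuous_of_blNorm_le_one hκ hf
    have hgc := continuous_of_blNorm_le_one hκ (ht1 g hg)
    have h1 := abs_setIntegral_sub_le_of_forall_abs_sub_le 
      (hmn.trans (le_max_left _ (μ.real (Metric.closedBall ρ r))))
      (by positivity) hfc hgc hfg
    have h2 := abs_setIntegral_sub_le_of_forall_abs_sub_le
      (le_max_right m (μ.real (Metric.closedBall ρ r))) (by positivity) hfc hgc hfg
    rw [← hM, div_mul_cancel₀ _ hM0.ne'] at h1 h2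
    have h3 := hn g hg
    rw [Real.enorm_eq_ofReal_abs]
    refine ENNReal.ofReal_le_ofReal ?_
    rw [abs_le] at *
    rw [abs_lt] at h3
    constructor <;> linarith
  refine ENNReal.tendsto_nhds_zero.2 fun ε hε => ?_
  rcases eq_or_ne ε ⊤ with rfl | hε'
  · simp
  · filter_upwards [key ε.toReal (ENNReal.toReal_pos hε.ne' hε')] with n hn
    rwa [ENNReal.ofReal_toReal hε'] at hn

theorem abs_infDist_sub_infDist_le {Z : Type u} [MetricSpace Z] (B : Set Z) (x y : Z) :
    |Metric.infDist x B - Metric.infDist y B| ≤ dist x y := by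
  rw [← Real.dist_eq]
  simpa using (Metric.lipschitz_infDist_pt B).dist_le_mul x y

/-- The function `max 0 (1 - infDist z B / ε)` lies between the indicators of `B` and of its
`ε`-thickening. The factor `4 + ε⁻¹` is `3 * C + L + 1` for its bound `C = 1` and Lipschitz constant
`L = ε⁻¹`. -/
theorem measure_le_measure_thickening_add {Z : Type u} [MetricSpace Z] [MeasurableSpace Z]
    [BorelSpace Z] {μ ν : Measure Z} [IsFiniteMeasure μ]
    [IsFiniteMeasure ν] {ε : ℝ} (hε : 0 < ε)
    (h : ENNReal.ofReal (4 + ε⁻¹) * blDist 1 μ ν ≤ ENNReal.ofReal ε) {B : Set Z}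
    (hB : MeasurableSet B) :
    μ B ≤ ν (Metric.thickening ε B) + ENNReal.ofReal ε := by
  rcases B.eq_empty_or_nonempty with rfl | hBn
  · simp
  set ψ : Z → ℝ := fun z => max 0 (1 - ε⁻¹ * Metric.infDist z B) with hψdef
  have hψc : Continuous ψ := by
    have := Metric.continuous_infDist_pt B
    fun_prop
  have hψ0 : ∀ z, 0 ≤ ψ z := fun z => le_max_left _ _
  have hψ1 : ∀ z, ψ z ≤ 1 := fun z => max_le zero_le_one (by
    have : 0 ≤ ε⁻¹ * Metric.infDist z B := mul_nonneg (by positivity) Metric.infDist_nonneg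
    linarith)
  have hψL : ∀ x y, |ψ x - ψ y| ≤ ε⁻¹ * dist x y := fun x y => by
    refine (abs_max_sub_max_le_max 0 _ 0 _).trans (max_le (by simp; positivity) ?_)
    rw [show 1 - ε⁻¹ * Metric.infDist x B - (1 - ε⁻¹ * Metric.infDist y B) =
      ε⁻¹ * (Metric.infDist y B - Metric.infDist x B) by ring, abs_mul,
      abs_of_pos (inv_pos.2 hε), dist_comm]
    gcongr
    exact abs_infDist_sub_infDist_le B y x
  have hint : ∀ ξ : Measure Z, IsFiniteMeasure ξ → Integrable ψ ξ := fun ξ _ =>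
    (integrable_const (1 : ℝ)).mono' hψc.aestronglyMeasurable (Eventually.of_forall fun z => by
      rw [Real.norm_of_nonneg (hψ0 z)]; exact hψ1 z)
  have h1 : μ.real B ≤ ∫ z, ψ z ∂μ := by
    rw [← integral_indicator_one hB]
    refine integral_mono ((integrable_indicator_iff hB).2 (integrable_const _).integrableOn)
      (hint μ inferInstance) fun z => ?_
    refine Set.indicator_le' (fun a ha => ?_) (fun a _ => hψ0 a) z
    simp [hψdef, Metric.infDist_zero_of_mem ha]
  have hTm : MeasurableSet (Metric.thickening ε B) := Metric.isOpen_thickening.measurableSet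
  have h2 : ∫ z, ψ z ∂ν ≤ ν.real (Metric.thickening ε B) := by
    rw [← integral_indicator_one hTm]
    refine integral_mono (hint ν inferInstance)
      ((integrable_indicator_iff hTm).2 (integrable_const _).integrableOn) fun z => ?_
    by_cases hz : z ∈ Metric.thickening ε B
    · simpa [hz] using hψ1 z
    · have hz' : ε ≤ Metric.infDist z B :=
        not_lt.1 fun hlt => hz ((Metric.mem_thickening_iff_infDist_lt hBn).2 hlt)
      have : 1 ≤ ε⁻¹ * Metric.infDist z B := by
        rw [inv_mul_eq_div, one_le_div hε]; exact hz'
      rw [show ψ z = 0 from max_eq_left (by linarith)]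
      exact Set.indicator_nonneg (fun _ _ => zero_le_one) z
  have h3 := enorm_integral_sub_le_blDist one_pos le_rfl hψL
    (fun z => by rw [abs_of_nonneg (hψ0 z)]; exact hψ1 z) (by positivity) zero_le_one μ ν
  rw [show 3 * 1 + ε⁻¹ + 1 = 4 + ε⁻¹ by ring] at h3
  replace h3 := h3.trans h
  rw [Real.enorm_eq_ofReal_abs, ENNReal.ofReal_le_ofReal_iff hε.le] at h3
  have h4 : μ.real B ≤ ν.real (Metric.thickening ε B) + ε := by
    linarith [le_abs_self (∫ z, ψ z ∂μ - ∫ z, ψ z ∂ν)]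
  rw [← ofReal_measureReal (μ := μ), ← ofReal_measureReal (μ := ν),
    ← ENNReal.ofReal_add measureReal_nonneg hε.le]
  exact ENNReal.ofReal_le_ofReal h4

theorem blDist_comm {Z : Type u} [MetricSpace Z] [MeasurableSpace Z] (κ : ℝ) (μ ν : Measure Z) : blDist κ μ ν = blDist κ ν μ := by
  simp only [blDist, enorm_sub_rev]

theorem levyProkhorovEDist_le_of_blDist_le {Z : Type u} [MetricSpace Z] [MeasurableSpace Z]
    [BorelSpace Z] {μ ν : Measure Z} [IsFiniteMeasure μ]
    [IsFiniteMeasure ν] {ε : ℝ} (hε : 0 < ε)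
    (h : ENNReal.ofReal (4 + ε⁻¹) * blDist 1 μ ν ≤ ENNReal.ofReal ε) :
    levyProkhorovEDist μ ν ≤ ENNReal.ofReal ε := by
  refine sInf_le fun B hB => ?_
  rw [ENNReal.toReal_ofReal hε.le]
  exact ⟨measure_le_measure_thickening_add hε h hB,
    measure_le_measure_thickening_add hε (by rwa [blDist_comm]) hB⟩

theorem tendsto_levyProkhorovEDist_of_tendsto_blDist {Z : Type u} [MetricSpace Z]
    [MeasurableSpace Z] [BorelSpace Z] {μs : ℕ → Measure Z} {μ : Measure Z}
    [∀ n, IsFiniteMeasure (μs n)] [IsFiniteMeasure μ]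
    (h : Tendsto (fun n => blDist 1 (μs n) μ) atTop (𝓝 0)) :
    Tendsto (fun n => levyProkhorovEDist (μs n) μ) atTop (𝓝 0) := by
  refine ENNReal.tendsto_nhds_zero.2 fun ε hε => ?_
  rcases eq_or_ne ε ⊤ with rfl | hε'
  · simp
  have hpos := ENNReal.toReal_pos hε.ne' hε'
  have h2 := ENNReal.Tendsto.const_mul (a := ENNReal.ofReal (4 + ε.toReal⁻¹)) h
    (Or.inr ENNReal.ofReal_ne_top)
  rw [mul_zero] at h2
  filter_upwards [h2.eventually (ge_mem_nhds (ENNReal.ofReal_pos.2 hpos))] with n hn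
  exact (levyProkhorovEDist_le_of_blDist_le hpos hn).trans_eq (ENNReal.ofReal_toReal hε')

theorem ae_measure_sphere_eq_zero (μ : Measure Z) [SFinite μ] (ρ : Z) :
    ∀ᵐ r : ℝ, μ (Metric.sphere ρ r) = 0 := by
  have : Measurable fun z => dist z ρ := by fun_prop
  filter_upwards [(Measure.countable_meas_level_set_pos (μ := μ) this).ae_notMem volume] with r hr
  exact nonpos_iff_eq_zero.1 (not_lt.1 hr)

theorem VagueTendsto.tendsto_rootedBLDist {κ : ℝ} (hκ : 0 < κ) {μs : ℕ → Measure Z}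
    {μ : Measure Z} [∀ n, IsFiniteMeasureOnCompacts (μs n)] [IsFiniteMeasureOnCompacts μ]
    (h : VagueTendsto μs μ) (ρ : Z) :
    Tendsto (fun n => rootedBLDist κ ρ (μs n) μ) atTop (𝓝 0) :=
  tendsto_localize ((ae_measure_sphere_eq_zero μ ρ).mono fun _ hr =>
    h.tendsto_blDist_restrict hκ hr)

theorem VagueTendsto.tendsto_rootedProkhorovDist {μs : ℕ → Measure Z}
    {μ : Measure Z} [∀ n, IsFiniteMeasureOnCompacts (μs n)] [IsFiniteMeasureOnCompacts μ]
    (h : VagueTendsto μs μ) (ρ : Z) :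
    Tendsto (fun n => rootedProkhorovDist ρ (μs n) μ) atTop (𝓝 0) := by
  refine tendsto_localize ((ae_measure_sphere_eq_zero μ ρ).mono fun r hr => ?_)
  have hfin : ∀ ξ : Measure Z, IsFiniteMeasureOnCompacts ξ →
      IsFiniteMeasure (ξ.restrict (Metric.closedBall ρ r)) := fun ξ _ =>
    isFiniteMeasure_restrict.2 (isCompact_closedBall ρ r).measure_lt_top.ne
  have := hfin μ inferInstance
  have := fun n => hfin (μs n) inferInstance
  exact tendsto_levyProkhorovEDist_of_tendsto_blDist (h.tendsto_blDist_restrict one_pos hr)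
end

/-! ### Gluing a sequence of spaces along a common subspace -/

/-- The disjoint union of a sequence of spaces, as the carrier of the glued pseudometric. -/
structure GluePoint (Z : ℕ → Type u) : Type u where
  idx : ℕ
  pt : Z idx

section
variable {X : Type u} {Z : ℕ → Type u} [∀ n, MetricSpace (Z n)]

/-- The extended distance between two points of the same piece, and `∞` otherwise. -/
noncomputable def pieceEDist (p q : GluePoint Z) : ℝ≥0∞ :=
  ⨅ h : p.idx = q.idx, edist (h ▸ p.pt) q.pt

/-- The distance along paths through the common subspace `X`. -/
noncomputable def bridgeEDist (g : ∀ n, X → Z n) (p q : GluePoint Z) : ℝ≥0∞ :=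
  ⨅ x, edist p.pt (g p.idx x) + edist (g q.idx x) q.pt

theorem pieceEDist_mk (n : ℕ) (a b : Z n) : pieceEDist ⟨n, a⟩ ⟨n, b⟩ = edist a b := by
  simp [pieceEDist]

theorem pieceEDist_comm (p q : GluePoint Z) : pieceEDist p q = pieceEDist q p := by
  obtain ⟨n, a⟩ := p
  obtain ⟨m, b⟩ := q
  by_cases h : n = m
  · subst h
    rw [pieceEDist_mk, pieceEDist_mk, edist_comm]
  · simp [pieceEDist, h, Ne.symm h]

theorem bridgeEDist_comm (g : ∀ n, X → Z n) (p q : GluePoint Z) :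
    bridgeEDist g p q = bridgeEDist g q p := by
  refine iInf_congr fun x => ?_
  rw [add_comm, edist_comm, edist_comm p.pt]

theorem pieceEDist_triangle (p q r : GluePoint Z) :
    pieceEDist p r ≤ pieceEDist p q + pieceEDist q r := by
  obtain ⟨n, a⟩ := p
  obtain ⟨m, b⟩ := q
  obtain ⟨k, c⟩ := r
  by_cases h : n = m
  · subst h
    by_cases h : n = k
    · subst h
      simp only [pieceEDist_mk]
      exact edist_triangle _ _ _
    · simp [pieceEDist, h]
  · simp [pieceEDist, h]

theorem bridgeEDist_le_pieceEDist_add (g : ∀ n, X → Z n) (p q r : GluePoint Z) :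
    bridgeEDist g p r ≤ pieceEDist p q + bridgeEDist g q r := by
  obtain ⟨n, a⟩ := p
  obtain ⟨m, b⟩ := q
  by_cases h : n = m
  · subst h
    rw [pieceEDist_mk, bridgeEDist, bridgeEDist, ENNReal.add_iInf]
    refine iInf_mono fun x => ?_
    rw [← add_assoc]
    gcongr
    exact edist_triangle _ _ _
  · simp [pieceEDist, h]

/-- A path that enters the piece of `q` at `x` and leaves it at `y` covers there at least the
distance from `x` to `y` in `X`. Since all `g n` are isometries, that stretch can be travelled in
the piece of `p` instead. -/
theorem bridgeEDist_triangle [MetricSpace X] {g : ∀ n, X → Z n} (hg : ∀ n, Isometry (g n)) (p q r : GluePoint Z) :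
    bridgeEDist g p r ≤ bridgeEDist g p q + bridgeEDist g q r := by
  rw [bridgeEDist, bridgeEDist, bridgeEDist, ENNReal.iInf_add]
  refine le_iInf fun x => ?_
  rw [ENNReal.add_iInf]
  refine le_iInf fun y => (iInf_le _ y).trans ?_
  have h1 := edist_triangle p.pt (g p.idx x) (g p.idx y)
  have h2 := edist_triangle (g q.idx x) q.pt (g q.idx y)
  rw [(hg _).edist_eq] at h1 h2
  calc edist p.pt (g p.idx y) + edist (g r.idx y) r.pt
      ≤ edist p.pt (g p.idx x) + (edist (g q.idx x) q.pt + edist q.pt (g q.idx y)) +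
        edist (g r.idx y) r.pt := by
        gcongr
        exact h1.trans (by gcongr)
    _ = _ := by ring

theorem edist_le_bridgeEDist (g : ∀ n, X → Z n) (n : ℕ) (a b : Z n) :
    edist a b ≤ bridgeEDist g ⟨n, a⟩ ⟨n, b⟩ :=
  le_iInf fun x => edist_triangle a (g n x) b

/-- The glued pseudometric, with extended values. -/
noncomputable abbrev gluePseudoEMetricSpace [MetricSpace X] {g : ∀ n, X → Z n} (hg : ∀ n, Isometry (g n)) :
    PseudoEMetricSpace (GluePoint Z) where
  edist p q := min (pieceEDist p q) (bridgeEDist g p q)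
  edist_self p := by
    refine nonpos_iff_eq_zero.1 ((min_le_left _ _).trans_eq ?_)
    exact (pieceEDist_mk p.idx p.pt p.pt).trans (edist_self _)
  edist_comm p q := by rw [pieceEDist_comm, bridgeEDist_comm]
  edist_triangle p q r := by
    have h1 := pieceEDist_triangle p q r
    have h2 := bridgeEDist_le_pieceEDist_add g p q r
    have h3 := bridgeEDist_le_pieceEDist_add g r q p
    have h4 := bridgeEDist_triangle hg p q r
    rw [bridgeEDist_comm g r p, pieceEDist_comm r q, bridgeEDist_comm g q p, add_comm] at h3
    rcases min_choice (pieceEDist p q) (bridgeEDist g p q) with e1 | e1 <;>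
    rcases min_choice (pieceEDist q r) (bridgeEDist g q r) with e2 | e2 <;> rw [e1, e2]
    · exact (min_le_left _ _).trans h1
    · exact (min_le_right _ _).trans h2
    · exact (min_le_right _ _).trans h3
    · exact (min_le_right _ _).trans h4

/-- The glued pseudometric. -/
noncomputable abbrev gluePseudoMetricSpace [MetricSpace X] [Nonempty X] {g : ∀ n, X → Z n}
    (hg : ∀ n, Isometry (g n)) : PseudoMetricSpace (GluePoint Z) :=
  letI := gluePseudoEMetricSpace hg
  PseudoEMetricSpace.toPseudoMetricSpace fun p q => by
    obtain ⟨x⟩ := ‹Nonempty X›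
    exact ne_top_of_le_ne_top (ENNReal.add_ne_top.2 ⟨edist_ne_top _ _, edist_ne_top _ _⟩)
      ((min_le_right _ _).trans (iInf_le _ x))

/-- Within one piece a detour through `X` is never shorter, so the pieces embed isometrically. The
copies of a point of `X` are at bridge distance `0` and merge in the separation quotient. -/
theorem exists_isometry_glue [MetricSpace X] [Nonempty X] {g : ∀ n, X → Z n} (hg : ∀ n, Isometry (g n)) :
    ∃ (W : Type u) (_ : MetricSpace W) (h : ∀ n, Z n → W), (∀ n, Isometry (h n)) ∧
      ∀ n m x, h n (g n x) = h m (g m x) := by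
  let _ := gluePseudoMetricSpace hg
  refine ⟨SeparationQuotient (GluePoint Z), inferInstance,
    fun n a => SeparationQuotient.mk ⟨n, a⟩, fun n a b => ?_, fun n m x => ?_⟩
  · rw [SeparationQuotient.edist_mk]
    refine Eq.trans ?_ (pieceEDist_mk n a b)
    refine min_eq_left ?_
    rw [pieceEDist_mk]
    exact edist_le_bridgeEDist g n a b
  · rw [SeparationQuotient.mk_eq_mk, EMetric.inseparable_iff]
    refine nonpos_iff_eq_zero.1 ((min_le_right _ _).trans ((iInf_le _ x).trans_eq ?_))
    simp
end

/-! ### Isometric copies in a metric space -/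

theorem Isometry.isCompact_range_inter_closedBall {Y W : Type*} [MetricSpace Y] [ProperSpace Y]
    [MetricSpace W] {h : Y → W} (hh : Isometry h) (y : Y) (R : ℝ) :
    IsCompact (Set.range h ∩ Metric.closedBall (h y) R) := by
  convert (isCompact_closedBall y R).image hh.continuous using 1
  rw [← hh.preimage_closedBall, Set.image_preimage_eq_inter_range, Set.inter_comm]

theorem Isometry.isFiniteMeasureOnCompacts_map {Y W : Type*} [MetricSpace Y] [ProperSpace Y]
    [MeasurableSpace Y] [BorelSpace Y] [MetricSpace W] [MeasurableSpace W] [BorelSpace W]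
    {h : Y → W} (hh : Isometry h) (μ : Measure Y) [IsFiniteMeasureOnCompacts μ] :
    IsFiniteMeasureOnCompacts (μ.map h) :=
  ⟨fun K hK => by
    rw [Measure.map_apply hh.continuous.measurable hK.isClosed.measurableSet]
    exact (hh.isClosedEmbedding.isCompact_preimage hK).measure_lt_top⟩

/-- A sequence that visits one copy infinitely often subconverges by compactness inside that copy.
Otherwise it leaves every copy, its indices tend to infinity, and closeness supplies asymptotic
partners in the copy of `X`, where bounded sequences subconverge. -/
theorem isCompact_union_range_inter_closedBall {W : Type*} [MetricSpace W] {Y : ℕ → Type*}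
    [∀ n, MetricSpace (Y n)] [∀ n, ProperSpace (Y n)] {X : Type*} [MetricSpace X] [ProperSpace X]
    {h : ∀ n, Y n → W} (hh : ∀ n, Isometry (h n)) {h₀ : X → W} (hh₀ : Isometry h₀)
    {y : ∀ n, Y n} {x : X} (hroot : ∀ n, h n (y n) = h₀ x) (R : ℝ)
    (hclose : ∀ δ : ℝ, 0 < δ → ∀ᶠ n in atTop,
      ∀ a ∈ Set.range (h n), dist a (h₀ x) ≤ R → ∃ b ∈ Set.range h₀, dist a b < δ) :
    IsCompact ((Set.range h₀ ∪ ⋃ n, Set.range (h n)) ∩ Metric.closedBall (h₀ x) R) := by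
  refine IsSeqCompact.isCompact fun u hu => ?_
  have sub : ∀ (T : Set W), IsCompact (T ∩ Metric.closedBall (h₀ x) R) →
      T ⊆ Set.range h₀ ∪ ⋃ n, Set.range (h n) → (∃ᶠ k in atTop, u k ∈ T) →
      ∃ a ∈ (Set.range h₀ ∪ ⋃ n, Set.range (h n)) ∩ Metric.closedBall (h₀ x) R,
        ∃ φ : ℕ → ℕ, StrictMono φ ∧ Tendsto (u ∘ φ) atTop (𝓝 a) := by
    intro T hT hTS hfr
    obtain ⟨a, ha, φ, hφ, hlim⟩ := hT.tendsto_subseq'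
      (hfr.mono fun k hk => Set.mem_inter hk (hu k).2)
    exact ⟨a, ⟨hTS ha.1, ha.2⟩, φ, hφ, hlim⟩
  by_cases h1 : ∃ᶠ k in atTop, u k ∈ Set.range h₀
  · exact sub _ (hh₀.isCompact_range_inter_closedBall x R) Set.subset_union_left h1
  by_cases h2 : ∃ n, ∃ᶠ k in atTop, u k ∈ Set.range (h n)
  · obtain ⟨n, hn⟩ := h2
    refine sub _ ?_ (Set.subset_union_of_subset_right (Set.subset_iUnion _ n) _) hn
    rw [← hroot n]
    exact (hh n).isCompact_range_inter_closedBall (y n) R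
  push Not at h1 h2
  have hnear : ∀ δ : ℝ, 0 < δ → ∀ᶠ k in atTop, ∃ b ∈ Set.range h₀, dist (u k) b < δ := by
    intro δ hδ
    obtain ⟨N, hN⟩ := eventually_atTop.1 (hclose δ hδ)
    have hlt : ∀ᶠ k in atTop, ∀ n ∈ Set.Iio N, u k ∉ Set.range (h n) :=
      (Set.finite_Iio N).eventually_all.2 fun n _ => h2 n
    filter_upwards [hlt, h1] with k hk hk1
    obtain ⟨n, hn⟩ := Set.mem_iUnion.1 ((hu k).1.resolve_left hk1)
    exact hN n (not_lt.1 fun hlt => hk n hlt hn) _ hn (hu k).2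
  have hinf : Tendsto (fun k => Metric.infDist (u k) (Set.range h₀)) atTop (𝓝 0) := by
    refine Metric.tendsto_nhds.2 fun δ hδ => ?_
    filter_upwards [hnear δ hδ] with k ⟨b, hb, hkb⟩
    rw [Real.dist_0_eq_abs, abs_of_nonneg Metric.infDist_nonneg]
    exact (Metric.infDist_le_dist_of_mem hb).trans_lt hkb
  -- A single sequence of partners, independent of `δ`; the slack `1 / (k + 1)` avoids asking that
  -- the infimum be attained.
  have hex : ∀ k, ∃ b ∈ Set.range h₀,
      dist (u k) b < Metric.infDist (u k) (Set.range h₀) + 1 / ((k : ℝ) + 1) := fun k =>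
    (Metric.infDist_lt_iff (Set.range_nonempty_iff_nonempty.2 ⟨x⟩)).1 (lt_add_of_pos_right _ (by positivity))
  choose b hb hub using hex
  have hdist : Tendsto (fun k => dist (u k) (b k)) atTop (𝓝 0) :=
    squeeze_zero (fun _ => dist_nonneg) (fun k => (hub k).le)
      (by simpa using hinf.add tendsto_one_div_add_atTop_nhds_zero_nat)
  have hbb : ∀ᶠ k in atTop, b k ∈ Set.range h₀ ∩ Metric.closedBall (h₀ x) (R + 1) := by
    filter_upwards [hdist.eventually (gt_mem_nhds one_pos)] with k hk
    have hk' : dist (u k) (h₀ x) ≤ R := (hu k).2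
    exact ⟨hb k, Metric.mem_closedBall.2 (by linarith [dist_triangle_left (b k) (h₀ x) (u k)])⟩
  obtain ⟨a, ha, φ, hφ, hlim⟩ :=
    (hh₀.isCompact_range_inter_closedBall x (R + 1)).tendsto_subseq' hbb.frequently
  have hulim : Tendsto (u ∘ φ) atTop (𝓝 a) := by
    refine tendsto_iff_dist_tendsto_zero.2 (squeeze_zero (fun _ => dist_nonneg)
      (fun k => dist_triangle (u (φ k)) (b (φ k)) a) ?_)
    simpa using (hdist.comp hφ.tendsto_atTop).add (tendsto_iff_dist_tendsto_zero.1 hlim)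
  exact ⟨a, ⟨Set.mem_union_left _ ha.1, Metric.isClosed_closedBall.mem_of_tendsto hulim
    (Eventually.of_forall fun k => (hu (φ k)).2)⟩, φ, hφ, hulim⟩

theorem properSpace_of_isCompact_inter_closedBall {W : Type*} [MetricSpace W] {S : Set W} (ρ : S)
    (h : ∀ R : ℝ, IsCompact (S ∩ Metric.closedBall (ρ : W) R)) : ProperSpace S := by
  refine ProperSpace.of_seq_closedBall (l := (atTop : Filter ℝ)) (x := ρ) tendsto_id
    (Eventually.of_forall fun R => ?_)
  rw [Subtype.isCompact_iff]
  convert h R using 1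
  ext w
  simp [and_comm]

/-! ### Lipschitz test functions with bounded support -/

/-- A nonnegative `L`-Lipschitz function bounded by `C` which vanishes at distance more than `R`
from `ρ`. -/
structure IsLipschitzTest {Z : Type u} [MetricSpace Z] (ρ : Z) (ψ : Z → ℝ) (L C R : ℝ) :
    Prop where
  L_nonneg : 0 ≤ L
  C_nonneg : 0 ≤ C
  R_nonneg : 0 ≤ R
  lip : ∀ x y, |ψ x - ψ y| ≤ L * dist x y
  nonneg : ∀ z, 0 ≤ ψ z
  le : ∀ z, ψ z ≤ C
  supp : ∀ z, R < dist z ρ → ψ z = 0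

theorem IsLipschitzTest.continuous {Z : Type u} [MetricSpace Z] {ρ : Z} {ψ : Z → ℝ} {L C R : ℝ}
    (h : IsLipschitzTest ρ ψ L C R) : Continuous ψ :=
  (LipschitzWith.of_dist_le_mul (K := L.toNNReal) fun x y => by
    rw [Real.coe_toNNReal _ h.L_nonneg, Real.dist_eq]; exact h.lip x y).continuous

theorem IsLipschitzTest.comp_isometry {Y Z : Type u} [MetricSpace Y] [MetricSpace Z] {ρ : Z}
    {ψ : Z → ℝ} {L C R : ℝ} (h : IsLipschitzTest ρ ψ L C R) {f : Y → Z} (hf : Isometry f) {y : Y}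
    (hy : f y = ρ) : IsLipschitzTest y (ψ ∘ f) L C R where
  L_nonneg := h.L_nonneg
  C_nonneg := h.C_nonneg
  R_nonneg := h.R_nonneg
  lip a b := by simpa [hf.dist_eq] using h.lip (f a) (f b)
  nonneg z := h.nonneg _
  le z := h.le _
  supp z hz := h.supp _ (by rwa [← hy, hf.dist_eq])

theorem isLipschitzTest_tent {Z : Type u} [MetricSpace Z] (ρ : Z) {R : ℝ} (hR : 0 ≤ R) :
    IsLipschitzTest ρ (fun z => max 0 (R - dist z ρ)) 1 R R where
  L_nonneg := zero_le_one
  C_nonneg := hR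
  R_nonneg := hR
  lip x y := by
    refine (abs_max_sub_max_le_max 0 _ 0 _).trans (max_le (by simp) ?_)
    rw [one_mul, sub_sub_sub_cancel_left, abs_sub_comm]
    exact abs_dist_sub_le x y ρ
  nonneg z := le_max_left _ _
  le z := max_le hR (by linarith [dist_nonneg (x := z) (y := ρ)])
  supp z hz := max_eq_left (by linarith)

/-- The McShane extension need not be nonnegative or have bounded support, so it is truncated
between `0` and `C * t`. The tent `t` has radius `R + 1`, hence is at least `1` on the ball of
radius `R`, and on `S` the truncation changes nothing. -/
theorem IsLipschitzTest.exists_extend {W : Type u} [MetricSpace W] {S : Set W} {ρ : S}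
    {ψ : S → ℝ} {L C R : ℝ} (h : IsLipschitzTest ρ ψ L C R) :
    ∃ ψ' : W → ℝ, (∃ L' C' R', IsLipschitzTest (ρ : W) ψ' L' C' R') ∧ ∀ z : S, ψ' z = ψ z := by
  classical
  obtain ⟨g, hg, hgS⟩ := LipschitzOnWith.extend_real (K := L.toNNReal) (s := S)
    (f := fun w => if hw : w ∈ S then ψ ⟨w, hw⟩ else 0) (LipschitzOnWith.of_dist_le_mul
      fun x hx y hy => by
        rw [Real.coe_toNNReal _ h.L_nonneg, Real.dist_eq]
        simpa [hx, hy, Subtype.dist_eq] using h.lip ⟨x, hx⟩ ⟨y, hy⟩)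
  have hgz : ∀ z : S, g z = ψ z := fun z => by simpa using (hgS z.2).symm
  have hgL : ∀ x y, |g x - g y| ≤ L * dist x y := fun x y => by
    simpa [Real.dist_eq, Real.coe_toNNReal _ h.L_nonneg] using hg.dist_le_mul x y
  have hC := h.C_nonneg
  have ht := isLipschitzTest_tent (ρ : W) (R := R + 1) (by linarith [h.R_nonneg])
  set t : W → ℝ := fun z => max 0 (R + 1 - dist z ρ) with htdef
  refine ⟨fun w => max 0 (min (g w) (C * t w)), ⟨max L C, C * (R + 1), R + 1, ?_⟩, fun z => ?_⟩
  · refine ⟨le_max_of_le_left h.L_nonneg, mul_nonneg hC ht.C_nonneg, ht.R_nonneg, fun x y => ?_,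
      fun z => le_max_left _ _, fun z => ?_, fun z hz => ?_⟩
    · refine (abs_max_sub_max_le_max 0 _ 0 _).trans (max_le ?_ ?_)
      · simpa using mul_nonneg (le_max_of_le_left h.L_nonneg) dist_nonneg
      refine (abs_min_sub_min_le_max _ _ _ _).trans (max_le ((hgL x y).trans ?_) ?_)
      · gcongr
        exact le_max_left _ _
      · rw [← mul_sub, abs_mul, abs_of_nonneg hC]
        have := ht.lip x y
        rw [one_mul] at this
        gcongr
        exact le_max_right _ _
    · refine max_le (mul_nonneg hC ht.C_nonneg) ((min_le_right _ _).trans ?_)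
      gcongr
      exact ht.le z
    · exact max_eq_left ((min_le_right _ _).trans (by rw [ht.supp z hz, mul_zero]))
  · show max 0 (min (g z) (C * t z)) = ψ z
    rw [hgz]
    rcases le_or_gt (dist (z : W) ρ) R with hle | hgt
    · have h1 : 1 ≤ t z := le_max_of_le_right (by linarith)
      rw [min_eq_left, max_eq_right (h.nonneg z)]
      nlinarith [h.le z]
    · have h0 : ψ z = 0 := h.supp z hgt
      rw [h0, min_eq_left (mul_nonneg hC (le_max_left _ _)), max_self]

/-- Inf-convolution with slope `C / δ`, where `δ` comes from uniform continuity: nearer than `δ` the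
function drops by less than `ε`, and beyond `δ` the penalty already exceeds or equals the bound `C`.
As `0 ≤ ψ ≤ φ`, bound and support are inherited. -/
theorem exists_isLipschitzTest_approx {Z : Type u} [MetricSpace Z] {φ : Z → ℝ}
    (hφ : UniformContinuous φ) (hφ₀ : ∀ z, 0 ≤ φ z) {C : ℝ} (hC : ∀ z, φ z ≤ C) {ρ : Z} {R : ℝ}
    (hR : 0 ≤ R) (hsupp : ∀ z, R < dist z ρ → φ z = 0) {ε : ℝ} (hε : 0 < ε) :
    ∃ ψ L, IsLipschitzTest ρ ψ L C R ∧ ∀ z, |φ z - ψ z| ≤ ε := by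
  have hC0 : 0 ≤ C := (hφ₀ ρ).trans (hC ρ)
  obtain ⟨δ, hδ, hφδ⟩ := Metric.uniformContinuous_iff.1 hφ ε hε
  have : Nonempty Z := ⟨ρ⟩
  have hL : 0 ≤ C / δ := by positivity
  have hbdd : ∀ x, BddBelow (Set.range fun y => φ y + C / δ * dist x y) := fun x =>
    ⟨0, by rintro _ ⟨y, rfl⟩; exact add_nonneg (hφ₀ y) (mul_nonneg hL dist_nonneg)⟩
  set ψ : Z → ℝ := fun x => ⨅ y, φ y + C / δ * dist x y with hψ
  have hψφ : ∀ z, ψ z ≤ φ z := fun z => by simpa using ciInf_le (hbdd z) z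
  have hψ0 : ∀ z, 0 ≤ ψ z := fun z =>
    le_ciInf fun y => add_nonneg (hφ₀ y) (mul_nonneg hL dist_nonneg)
  have hψL : ∀ x y, ψ x ≤ ψ y + C / δ * dist x y := fun x y => by
    rw [← sub_le_iff_le_add]
    refine le_ciInf fun z => ?_
    have h1 : ψ x ≤ φ z + C / δ * dist x z := ciInf_le (hbdd x) z
    have h2 := mul_le_mul_of_nonneg_left (dist_triangle x y z) hL
    linarith
  refine ⟨ψ, C / δ, ⟨hL, hC0, hR, fun x y => ?_, hψ0, fun z => (hψφ z).trans (hC z),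
    fun z hz => le_antisymm ((hψφ z).trans_eq (hsupp z hz)) (hψ0 z)⟩, fun z => ?_⟩
  · rw [abs_sub_le_iff]
    have h1 := hψL y x
    rw [dist_comm] at h1
    exact ⟨by linarith [hψL x y], by linarith⟩
  · rw [abs_of_nonneg (sub_nonneg.2 (hψφ z)), sub_le_comm]
    refine le_ciInf fun y => ?_
    rcases lt_or_ge (dist z y) δ with hlt | hge
    · have h1 := hφδ hlt
      rw [Real.dist_eq] at h1
      linarith [le_abs_self (φ z - φ y), mul_nonneg hL (dist_nonneg (x := z) (y := y))]
    · have h1 : C ≤ C / δ * dist z y := by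
        rw [div_mul_eq_mul_div, le_div_iff₀ hδ]
        exact mul_le_mul_of_nonneg_left hge hC0
      linarith [hC z, hφ₀ y]

theorem vagueTendsto_of_isLipschitzTest {Z : Type u} [MetricSpace Z] [ProperSpace Z]
    [MeasurableSpace Z] [BorelSpace Z] {μs : ℕ → Measure Z} {μ : Measure Z}
    [∀ n, IsFiniteMeasureOnCompacts (μs n)] [IsFiniteMeasureOnCompacts μ] (ρ : Z)
    (h : ∀ ψ L C R, IsLipschitzTest ρ ψ L C R →
      Tendsto (fun n => ∫ z, ψ z ∂(μs n)) atTop (𝓝 (∫ z, ψ z ∂μ))) : VagueTendsto μs μ := by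
  have main : ∀ φ : Z → ℝ, Continuous φ → HasCompactSupport φ → (∀ z, 0 ≤ φ z) →
      Tendsto (fun n => ∫ z, φ z ∂(μs n)) atTop (𝓝 (∫ z, φ z ∂μ)) := by
    intro φ hφc hφs hφ0
    obtain ⟨C, hC⟩ := hφs.exists_bound_of_continuous hφc
    obtain ⟨R', hR'⟩ := hφs.isBounded.subset_closedBall ρ
    set R := max R' 0 with hRdef
    have hR : 0 ≤ R := le_max_right _ _
    have hsupp : ∀ z, R < dist z ρ → φ z = 0 := fun z hz =>
      image_eq_zero_of_notMem_tsupport fun hz' =>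
        absurd ((Metric.mem_closedBall.1 (hR' hz')).trans (le_max_left _ 0)) (not_le.2 hz)
    -- A tent is itself a Lipschitz test, so the hypothesis bounds the masses of the ball and makes
    -- uniform approximation harmless.
    obtain ⟨m, hm0, hm⟩ := eventually_measureReal_closedBall_le (μs := μs) (μ := μ) ρ R
      (h _ _ _ _ (isLipschitzTest_tent ρ (R := R + 1) (by linarith)))
    set M := max m (μ.real (Metric.closedBall ρ R)) with hM
    have hM0 : 0 < M := lt_max_of_lt_left hm0
    refine Metric.tendsto_nhds.2 fun ε hε => ?_
    obtain ⟨ψ, L, hψ, hφψ⟩ := exists_isLipschitzTest_approx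
      (hφs.uniformContinuous_of_continuous hφc) hφ0
      (fun z => (le_abs_self _).trans (hC z)) hR hsupp (ε := ε / 3 / M) (by positivity)
    filter_upwards [hm, Metric.tendsto_nhds.1 (h ψ _ _ _ hψ) (ε / 3) (by positivity)]
      with n hn1 hn2
    have h1 := abs_setIntegral_sub_le_of_forall_abs_sub_le
      (hn1.trans (le_max_left _ (μ.real (Metric.closedBall ρ R))))
      (by positivity) hφc hψ.continuous (fun z _ => hφψ z)
    have h2 := abs_setIntegral_sub_le_of_forall_abs_sub_le
      (le_max_right m (μ.real (Metric.closedBall ρ R))) (by positivity) hφc hψ.continuous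
      (fun z _ => hφψ z)
    rw [← hM, div_mul_cancel₀ _ hM0.ne', setIntegral_closedBall_eq_integral le_rfl hsupp,
      setIntegral_closedBall_eq_integral le_rfl hψ.supp] at h1 h2
    rw [Real.dist_eq] at hn2 ⊢
    rw [abs_le] at h1 h2
    rw [abs_lt] at hn2 ⊢
    constructor <;> linarith
  intro φ hφc hφs
  have hp : HasCompactSupport fun z => max (φ z) 0 := hφs.comp_left (g := fun t => max t 0) (by simp)
  have hn : HasCompactSupport fun z => max (-φ z) 0 :=
    hφs.comp_left (g := fun t => max (-t) 0) (by simp)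
  have hpc : Continuous fun z => max (φ z) 0 := by fun_prop
  have hnc : Continuous fun z => max (-φ z) 0 := by fun_prop
  have key : ∀ ξ : Measure Z, IsFiniteMeasureOnCompacts ξ →
      ∫ z, φ z ∂ξ = ∫ z, max (φ z) 0 ∂ξ - ∫ z, max (-φ z) 0 ∂ξ := fun ξ _ => by
    rw [← integral_sub (hpc.integrable_of_hasCompactSupport hp)
      (hnc.integrable_of_hasCompactSupport hn)]
    exact integral_congr_ae (Eventually.of_forall fun z =>
      (max_zero_sub_max_neg_zero_eq_self (φ z)).symm)
  rw [key μ inferInstance]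
  simp_rw [fun n => key (μs n) inferInstance]
  exact (main _ hpc hp fun z => le_max_right _ _).sub (main _ hnc hn fun z => le_max_right _ _)

/-! ### Convergence in a common space -/

/-- Convergence of rooted-and-measured spaces under root-preserving embeddings into a common rooted
boundedly compact space. -/
def ConvergesInCommonSpace (Xs : ℕ → RootedMeasuredBCM.{u}) (X : RootedMeasuredBCM.{u}) : Prop :=
  ∃ (M : RootedBCM.{u}) (fs : ∀ n, RootedEmbedding (Xs n).toRootedBCM M)
    (f : RootedEmbedding X.toRootedBCM M),
    FellTendsto (fun n => Set.range (fs n)) (Set.range f) ∧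
    VagueTendsto (fun n => (Xs n).μ.map (fs n)) (X.μ.map f)

theorem integral_map_isometry {Y W : Type*} [MetricSpace Y] [MeasurableSpace Y] [BorelSpace Y]
    [SecondCountableTopology Y] [MetricSpace W] [MeasurableSpace W] [BorelSpace W] {h : Y → W}
    (hh : Isometry h) (μ : Measure Y) {ψ : W → ℝ} (hψ : Continuous ψ) :
    ∫ z, ψ z ∂(μ.map h) = ∫ y, ψ (h y) ∂μ := by
  refine integral_map hh.continuous.measurable.aemeasurable ?_
  exact hψ.stronglyMeasurable.aestronglyMeasurable

section
variable {Xs : ℕ → RootedMeasuredBCM.{u}} {X : RootedMeasuredBCM.{u}}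

/-- `W` is not assumed boundedly compact: the common space is the union `S` of all copies. Test
functions on `S` are extended to `W` to use the hypothesis there. -/
theorem convergesInCommonSpace_of_isometry {W : Type u} [MetricSpace W] {h : ∀ n, Xs n → W}
    (hh : ∀ n, Isometry (h n)) {h₀ : X → W} (hh₀ : Isometry h₀)
    (hroot : ∀ n, h n (Xs n).root = h₀ X.root)
    (hclose : ∀ R δ : ℝ, 0 < δ → ∀ᶠ n in atTop,
      LocallyClose (h₀ X.root) R δ (Set.range (h n)) (Set.range h₀))
    (htest : ∀ ψ L C R, IsLipschitzTest (h₀ X.root) ψ L C R →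
      Tendsto (fun n => ∫ y, ψ (h n y) ∂(Xs n).μ) atTop (𝓝 (∫ x, ψ (h₀ x) ∂X.μ))) :
    ConvergesInCommonSpace Xs X := by
  set S : Set W := Set.range h₀ ∪ ⋃ n, Set.range (h n) with hS
  let k : ∀ n, Xs n → S := fun n y =>
    ⟨h n y, Set.mem_union_right _ (Set.mem_iUnion.2 ⟨n, Set.mem_range_self y⟩)⟩
  let k₀ : X → S := fun x => ⟨h₀ x, Set.mem_union_left _ (Set.mem_range_self x)⟩
  have hk : ∀ n, Isometry (k n) := hh
  have hk₀ : Isometry k₀ := hh₀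
  have hP : ProperSpace S := properSpace_of_isCompact_inter_closedBall (k₀ X.root) fun R =>
    isCompact_union_range_inter_closedBall hh hh₀ hroot R fun δ hδ =>
      (hclose R δ hδ).mono fun n hn => hn.1
  let _ : MeasurableSpace S := borel S
  have hB : BorelSpace S := ⟨rfl⟩
  let M : RootedBCM.{u} := { carrier := S, root := k₀ X.root }
  have hkr : ∀ n, k n (Xs n).root = k₀ X.root := fun n => Subtype.ext (hroot n)
  refine ⟨M, fun n => ⟨k n, hk n, hkr n⟩, ⟨k₀, hk₀, rfl⟩, ?_, ?_⟩
  · refine fellTendsto_of_locallyClose (Z := S) (hk₀.isClosedEmbedding.isClosed_range) (k₀ X.root)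
      fun R δ hδ => (hclose R δ hδ).mono fun n hn => ⟨?_, ?_⟩
    · rintro _ ⟨y, rfl⟩ hy
      obtain ⟨_, ⟨x, rfl⟩, hx⟩ := hn.1 (h n y) ⟨y, rfl⟩ hy
      exact ⟨k₀ x, ⟨x, rfl⟩, hx⟩
    · rintro _ ⟨x, rfl⟩ hx
      obtain ⟨_, ⟨y, rfl⟩, hy⟩ := hn.2 (h₀ x) ⟨x, rfl⟩ hx
      exact ⟨k n y, ⟨y, rfl⟩, hy⟩
  · have h1 : ∀ n, IsFiniteMeasureOnCompacts ((Xs n).μ.map (k n)) := fun n =>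
      (hk n).isFiniteMeasureOnCompacts_map _
    have h2 : IsFiniteMeasureOnCompacts (X.μ.map k₀) := hk₀.isFiniteMeasureOnCompacts_map _
    refine vagueTendsto_of_isLipschitzTest (Z := S) (μs := fun n => (Xs n).μ.map (k n))
      (μ := X.μ.map k₀) (k₀ X.root) fun ψ L C R hψ => ?_
    obtain ⟨ψ', ⟨L', C', R', hψ'⟩, hψψ⟩ := hψ.exists_extend
    simp_rw [integral_map_isometry hk₀ _ hψ.continuous,
      fun n => integral_map_isometry (hk n) (Xs n).μ hψ.continuous]
    have := htest ψ' L' C' R' hψ'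
    simp_rw [← hψψ]
    exact this

/-- Kuratowski's embedding, lifted so that the target lives in the same universe as the spaces. -/
theorem exists_isometry_linfty (M : Type u) [MetricSpace M] [SecondCountableTopology M] :
    ∃ K : M → ULift.{u} (lp (fun _ : ℕ => ℝ) ⊤), Isometry K :=
  ⟨fun z => ULift.up (kuratowskiEmbedding M z), fun x y => by
    rw [ULift.edist_up_up]
    exact kuratowskiEmbedding.isometry M x y⟩

theorem Isometry.sub_const {Y E : Type*} [MetricSpace Y] [NormedAddCommGroup E] {K : Y → E}
    (hK : Isometry K) (v : E) : Isometry fun y => K y - v :=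
  Isometry.of_dist_eq fun x y => by rw [dist_sub_right, hK.dist_eq]

theorem convergesInCommonSpace_of_tendsto_root {M : BCM.{u}} {fs : ∀ n, Xs n → M} {f : X → M}
    (hfs : ∀ n, Isometry (fs n)) (hf : Isometry f)
    (hF : FellTendsto (fun n => Set.range (fs n)) (Set.range f))
    (hroot : Tendsto (fun n => fs n (Xs n).root) atTop (𝓝 (f X.root)))
    (hV : VagueTendsto (fun n => (Xs n).μ.map (fs n)) (X.μ.map f)) :
    ConvergesInCommonSpace Xs X := by
  obtain ⟨K, hK⟩ := exists_isometry_linfty M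
  have hroot' := tendsto_iff_dist_tendsto_zero.1 hroot
  have hshift : ∀ n (y z : M), dist (K y - K (fs n (Xs n).root)) (K z - K (f X.root)) ≤
      dist y z + dist (fs n (Xs n).root) (f X.root) := fun n y z => by
    rw [← hK.dist_eq y z, ← hK.dist_eq (fs n (Xs n).root)]
    exact dist_sub_sub_le _ _ _ _
  refine convergesInCommonSpace_of_isometry
    (h := fun n y => K (fs n y) - K (fs n (Xs n).root)) (h₀ := fun x => K (f x) - K (f X.root))
    (fun n => (hK.comp (hfs n)).sub_const _) ((hK.comp hf).sub_const _) (fun n => by simp) ?_ ?_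
  · intro R δ hδ
    filter_upwards [hF.eventually_locallyClose (f X.root) (R + 1) (half_pos hδ),
      hroot'.eventually (gt_mem_nhds one_pos), hroot'.eventually (gt_mem_nhds (half_pos hδ))]
      with n hn h1 h2
    refine ⟨?_, ?_⟩
    · rintro _ ⟨y, rfl⟩ hy
      rw [sub_self, dist_zero_right, ← dist_eq_norm, hK.dist_eq] at hy
      obtain ⟨_, ⟨x, rfl⟩, hx⟩ := hn.1 (fs n y) ⟨y, rfl⟩
        (by linarith [dist_triangle (fs n y) (fs n (Xs n).root) (f X.root)])
      exact ⟨_, ⟨x, rfl⟩, (hshift n _ _).trans_lt (by linarith)⟩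
    · rintro _ ⟨x, rfl⟩ hx
      rw [sub_self, dist_zero_right, ← dist_eq_norm, hK.dist_eq] at hx
      obtain ⟨_, ⟨y, rfl⟩, hy⟩ := hn.2 (f x) ⟨x, rfl⟩ (by linarith)
      refine ⟨_, ⟨y, rfl⟩, ?_⟩
      rw [dist_comm] at hy ⊢
      exact (hshift n _ _).trans_lt (by linarith)
  · intro ψ L C R hψ
    rw [sub_self] at hψ
    set φ : M → ℝ := fun z => ψ (K z - K (f X.root)) with hφ
    have hφt : IsLipschitzTest (f X.root) φ L C R :=
      hψ.comp_isometry (hK.sub_const _) (sub_self _)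
    have hlim := hV φ hφt.continuous (hasCompactSupport_of_dist hφt.supp)
    simp_rw [integral_map_isometry hf _ hφt.continuous,
      fun n => integral_map_isometry (hfs n) (Xs n).μ hφt.continuous] at hlim
    have hfin : ∀ n, IsFiniteMeasureOnCompacts ((Xs n).μ.map (fs n)) := fun n =>
      (hfs n).isFiniteMeasureOnCompacts_map _
    -- Once the roots are within `1`, both integrands vanish outside radius `R + 1` about the root
    -- of `Xs n`, and that ball maps into radius `R + 2` about `f X.root`.
    obtain ⟨m, hm0, hm⟩ := hV.eventually_measureReal_closedBall_le (f X.root) (R + 2)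
    have hdiff : Tendsto (fun n => ∫ y, ψ (K (fs n y) - K (fs n (Xs n).root)) ∂(Xs n).μ -
        ∫ y, φ (fs n y) ∂(Xs n).μ) atTop (𝓝 0) := by
      have hL : Tendsto (fun n => L * dist (fs n (Xs n).root) (f X.root) * m) atTop (𝓝 0) := by
        simpa using (hroot'.const_mul L).mul_const m
      refine squeeze_zero_norm' ?_ hL
      filter_upwards [hm, hroot'.eventually (gt_mem_nhds one_pos)] with n hn h1
      have hs1 : ∀ y, R + 1 < dist y (Xs n).root →
          ψ (K (fs n y) - K (fs n (Xs n).root)) = 0 := fun y hy => hψ.supp _ (by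
        rw [dist_zero_right, ← dist_eq_norm, hK.dist_eq, (hfs n).dist_eq]; linarith)
      have hs2 : ∀ y, R + 1 < dist y (Xs n).root → φ (fs n y) = 0 := fun y hy => hφt.supp _ (by
        rw [← (hfs n).dist_eq] at hy
        linarith [dist_triangle_right (fs n y) (fs n (Xs n).root) (f X.root)])
      rw [Real.norm_eq_abs, ← setIntegral_closedBall_eq_integral le_rfl hs1,
        ← setIntegral_closedBall_eq_integral le_rfl hs2]
      refine abs_setIntegral_sub_le_of_forall_abs_sub_le ?_
        (mul_nonneg hψ.L_nonneg dist_nonneg)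
        (hψ.continuous.comp ((hK.comp (hfs n)).sub_const _).continuous)
        (hφt.continuous.comp (hfs n).continuous) fun y _ => ?_
      · refine le_trans ?_ hn
        rw [measureReal_def, measureReal_def,
          Measure.map_apply (hfs n).continuous.measurable Metric.isClosed_closedBall.measurableSet]
        refine ENNReal.toReal_mono ?_ (measure_mono fun y hy => ?_)
        · exact ((hfs n).isClosedEmbedding.isCompact_preimage
            (isCompact_closedBall _ _)).measure_lt_top.ne
        · have hy' : dist y (Xs n).root ≤ R + 1 := hy
          rw [← (hfs n).dist_eq] at hy'
          exact Metric.mem_closedBall.2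
            (by linarith [dist_triangle (fs n y) (fs n (Xs n).root) (f X.root)])
      · refine (hψ.lip _ _).trans (mul_le_mul_of_nonneg_left ?_ hψ.L_nonneg)
        simpa using hshift n (fs n y) (fs n y)
    simpa using hdiff.add hlim

/-! ### From small distances to a common space -/

/-- There are root-preserving embeddings into a common metric space for which, at every scale that
`e` controls, the images are locally close and the integrals of Lipschitz test functions differ by
at most `K L C R * δ`. -/
def HasCloseEmbeddings (K : ℝ → ℝ → ℝ → ℝ) (e : ℝ≥0∞) (Y X : RootedMeasuredBCM.{u}) : Prop :=
  ∃ (Z : Type u) (_ : MetricSpace Z) (f : Y → Z) (g : X → Z), Isometry f ∧ Isometry g ∧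
    f Y.root = g X.root ∧ ∀ R δ : ℝ, 0 ≤ R → 0 < δ → δ ≤ 1 →
      e < ENNReal.ofReal (Real.exp (-(R + 1))) * ENNReal.ofReal δ →
      LocallyClose (g X.root) R δ (Set.range f) (Set.range g) ∧
      ∀ ψ L C, IsLipschitzTest (g X.root) ψ L C R →
        |∫ y, ψ (f y) ∂Y.μ - ∫ x, ψ (g x) ∂X.μ| ≤ K L C R * δ

/-- With `e = ⊤` no scale is controlled, so any embeddings sharing the root will do. This supplies a
space to glue at an index where the distance is not known to be finite. -/
theorem hasCloseEmbeddings_top (K : ℝ → ℝ → ℝ → ℝ) (Y X : RootedMeasuredBCM.{u}) :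
    HasCloseEmbeddings K ⊤ Y X := by
  obtain ⟨i, hi⟩ := exists_isometry_linfty Y
  obtain ⟨j, hj⟩ := exists_isometry_linfty X
  exact ⟨_, inferInstance, fun y => i y - i Y.root, fun x => j x - j X.root, hi.sub_const _,
    hj.sub_const _, by simp, fun R δ _ _ _ h => absurd h (not_lt.2 le_top)⟩

theorem hasCloseEmbeddings_of_ghBLDist_lt {κ : ℝ} (hκ₀ : 0 < κ) (hκ₁ : κ ≤ 1)
    {Y X : RootedMeasuredBCM.{u}} {e : ℝ≥0∞} (h : ghBLDist κ Y X < e) :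
    HasCloseEmbeddings (fun L C _ => 3 * C + L + 1) e Y X := by
  simp only [ghBLDist, iInf_lt_iff] at h
  obtain ⟨Z, f, g, hZ⟩ := h
  refine ⟨Z, inferInstance, f, g, f.isometry, g.isometry, f.map_root.trans g.map_root.symm,
    fun R δ hR hδ₀ hδ₁ he => ?_⟩
  obtain ⟨h1, h2⟩ := max_lt_iff.1 (hZ.trans he)
  rw [g.map_root]
  refine ⟨locallyClose_of_localHausdorffDist_lt hR hδ₁ h1, fun ψ L C hψ => ?_⟩
  have := abs_integral_sub_le_of_rootedBLDist_lt hκ₀ hκ₁ hR hδ₀.le hδ₁ h2 hψ.lip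
    (fun z => by rw [abs_of_nonneg (hψ.nonneg z)]; exact hψ.le z) hψ.L_nonneg hψ.C_nonneg hψ.supp
  rwa [integral_map_isometry f.isometry _ hψ.continuous,
    integral_map_isometry g.isometry _ hψ.continuous] at this

/-- The constant involves the mass of `X` only, so it is the same for every `Y` in a sequence
converging to `X`. -/
theorem hasCloseEmbeddings_of_ghVagueDist_lt {Y X : RootedMeasuredBCM.{u}} {e : ℝ≥0∞}
    (h : ghVagueDist Y X < e) :
    HasCloseEmbeddings
      (fun L C R => L * (X.μ.real (Metric.closedBall X.root (R + 1)) + 1) + C) e Y X := by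
  simp only [ghVagueDist, iInf_lt_iff] at h
  obtain ⟨Z, f, g, hZ⟩ := h
  refine ⟨Z, inferInstance, f, g, f.isometry, g.isometry, f.map_root.trans g.map_root.symm,
    fun R δ hR hδ₀ hδ₁ he => ?_⟩
  obtain ⟨h1, h2⟩ := max_lt_iff.1 (hZ.trans he)
  have hμ : IsFiniteMeasureOnCompacts (Y.μ.map f) := f.isometry.isFiniteMeasureOnCompacts_map _
  have hν : IsFiniteMeasureOnCompacts (X.μ.map g) := g.isometry.isFiniteMeasureOnCompacts_map _
  have hm : (X.μ.map g).real (Metric.closedBall Z.root (R + 1)) =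
      X.μ.real (Metric.closedBall X.root (R + 1)) := by
    rw [measureReal_def, measureReal_def, Measure.map_apply g.isometry.continuous.measurable
      Metric.isClosed_closedBall.measurableSet, ← g.map_root, g.isometry.preimage_closedBall]
  rw [g.map_root]
  refine ⟨locallyClose_of_localHausdorffDist_lt hR hδ₁ h1, fun ψ L C hψ => ?_⟩
  have := abs_integral_sub_le_of_rootedProkhorovDist_lt hR hδ₀ hδ₁ hm.le h2 hψ.lip hψ.nonneg
    hψ.le hψ.L_nonneg hψ.C_nonneg hψ.supp
  rwa [integral_map_isometry f.isometry _ hψ.continuous,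
    integral_map_isometry g.isometry _ hψ.continuous] at this

theorem convergesInCommonSpace_of_hasCloseEmbeddings {K : ℝ → ℝ → ℝ → ℝ} {e : ℕ → ℝ≥0∞}
    (he : Tendsto e atTop (𝓝 0)) (h : ∀ n, HasCloseEmbeddings K (e n) (Xs n) X) :
    ConvergesInCommonSpace Xs X := by
  choose Z mZ f g hf hg hroot hfg using h
  have : Nonempty X := ⟨X.root⟩
  obtain ⟨W, mW, i, hi, hig⟩ := exists_isometry_glue hg
  have hsmall : ∀ R δ : ℝ, 0 < δ → ∀ᶠ n in atTop,
      e n < ENNReal.ofReal (Real.exp (-(R + 1))) * ENNReal.ofReal δ := fun R δ hδ =>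
    he.eventually (gt_mem_nhds (ENNReal.mul_pos (by simp [Real.exp_pos]) (by simp [hδ])))
  -- After gluing, all the maps `i n ∘ g n` coincide; the index `0` is an arbitrary representative.
  refine convergesInCommonSpace_of_isometry (h := fun n y => i n (f n y))
    (h₀ := fun x => i 0 (g 0 x)) (fun n => (hi n).comp (hf n)) ((hi 0).comp (hg 0))
    (fun n => by rw [hroot n, hig n 0]) ?_ ?_
  · intro R δ hδ
    filter_upwards [hsmall (max R 0) (min δ 1) (by simp [hδ])] with n hn
    have h1 := (hfg n (max R 0) (min δ 1) (le_max_right _ _) (by simp [hδ]) (min_le_right _ _)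
      hn).1
    rw [hig 0 n]
    refine ⟨?_, ?_⟩
    · rintro _ ⟨y, rfl⟩ hy
      rw [(hi n).dist_eq] at hy
      obtain ⟨_, ⟨x, rfl⟩, hx⟩ := h1.1 _ ⟨y, rfl⟩ (hy.trans (le_max_left _ _))
      exact ⟨_, ⟨x, rfl⟩, by
        dsimp only
        rw [hig 0 n, (hi n).dist_eq]; exact hx.trans_le (min_le_left _ _)⟩
    · rintro _ ⟨x, rfl⟩ hx
      dsimp only at hx
      rw [hig 0 n, (hi n).dist_eq] at hx
      obtain ⟨_, ⟨y, rfl⟩, hy⟩ := h1.2 _ ⟨x, rfl⟩ (hx.trans (le_max_left _ _))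
      exact ⟨_, ⟨y, rfl⟩, by
        dsimp only
        rw [hig 0 n, (hi n).dist_eq]; exact hy.trans_le (min_le_left _ _)⟩
  · intro ψ L C R hψ
    refine Metric.tendsto_nhds.2 fun ε hε => ?_
    set δ := min 1 (ε / (|K L C R| + 1)) with hδdef
    have hδ : 0 < δ := lt_min one_pos (by positivity)
    filter_upwards [hsmall R δ hδ] with n hn
    have h1 := (hfg n R δ hψ.R_nonneg hδ (min_le_left _ _) hn).2 (ψ ∘ i n) L C
      (hψ.comp_isometry (hi n) (hig n 0 _))
    simp only [Function.comp_apply, hig n 0] at h1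
    rw [Real.dist_eq]
    refine h1.trans_lt ?_
    have h2 : (|K L C R| + 1) * δ ≤ ε := by
      rw [← le_div_iff₀' (by positivity)]
      exact min_le_right _ _
    nlinarith [le_abs_self (K L C R)]

theorem convergesInCommonSpace_of_tendsto_dist {K : ℝ → ℝ → ℝ → ℝ} {d : ℕ → ℝ≥0∞}
    (hd : Tendsto d atTop (𝓝 0))
    (h : ∀ n e, d n < e → HasCloseEmbeddings K e (Xs n) X) : ConvergesInCommonSpace Xs X := by
  -- The infimum defining the distance may not be attained; the added `1 / (n + 1)` leaves room for
  -- a near-minimizer.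
  refine convergesInCommonSpace_of_hasCloseEmbeddings (K := K)
    (e := fun n => d n + ENNReal.ofReal (1 / ((n : ℝ) + 1))) ?_ fun n => ?_
  · simpa using hd.add (ENNReal.tendsto_ofReal tendsto_one_div_add_atTop_nhds_zero_nat)
  · rcases eq_or_ne (d n) ⊤ with htop | htop
    · rw [htop, top_add]
      exact hasCloseEmbeddings_top K _ _
    · refine h n _ (ENNReal.lt_add_right htop ?_)
      simpa using (by positivity : (0 : ℝ) < (n : ℝ) + 1)

theorem ConvergesInCommonSpace.tendsto_ghBLDist {κ : ℝ} (hκ : 0 < κ)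
    (h : ConvergesInCommonSpace Xs X) : Tendsto (fun n => ghBLDist κ (Xs n) X) atTop (𝓝 0) := by
  obtain ⟨M, fs, f, hF, hV⟩ := h
  have h1 : ∀ n, IsFiniteMeasureOnCompacts ((Xs n).μ.map (fs n)) := fun n =>
    (fs n).isometry.isFiniteMeasureOnCompacts_map _
  have h2 : IsFiniteMeasureOnCompacts (X.μ.map f) := f.isometry.isFiniteMeasureOnCompacts_map _
  have hmax := (hF M.root).max (hV.tendsto_rootedBLDist hκ M.root)
  rw [max_self] at hmax
  exact tendsto_of_tendsto_of_tendsto_of_le_of_le tendsto_const_nhds hmax (fun _ => zero_le)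
    fun n => iInf_le_of_le M (iInf_le_of_le (fs n) (iInf_le_of_le f le_rfl))

theorem ConvergesInCommonSpace.ghVagueTendsto (h : ConvergesInCommonSpace Xs X) :
    GHVagueTendsto Xs X := by
  obtain ⟨M, fs, f, hF, hV⟩ := h
  have h1 : ∀ n, IsFiniteMeasureOnCompacts ((Xs n).μ.map (fs n)) := fun n =>
    (fs n).isometry.isFiniteMeasureOnCompacts_map _
  have h2 : IsFiniteMeasureOnCompacts (X.μ.map f) := f.isometry.isFiniteMeasureOnCompacts_map _
  have hmax := (hF M.root).max (hV.tendsto_rootedProkhorovDist M.root)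
  rw [max_self] at hmax
  exact tendsto_of_tendsto_of_tendsto_of_le_of_le tendsto_const_nhds hmax (fun _ => zero_le)
    fun n => iInf_le_of_le M (iInf_le_of_le (fs n) (iInf_le_of_le f le_rfl))

end

theorem theorem2p13 (κ : ℝ) (hκ₀ : 0 < κ) (hκ₁ : κ ≤ 1)
    (Xs : ℕ → RootedMeasuredBCM.{u}) (X : RootedMeasuredBCM.{u}) :
    List.TFAE [
      -- (i) root-preserving embeddings into a common rooted space
      ∃ (M : RootedBCM.{u}) (fs : ∀ n, RootedEmbedding (Xs n).toRootedBCM M)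
        (f : RootedEmbedding X.toRootedBCM M),
        FellTendsto (fun n => Set.range (fs n)) (Set.range f) ∧
        VagueTendsto (fun n => (Xs n).μ.map (fs n)) (X.μ.map f),
      -- (ii) embeddings into a common space, with convergence of the roots
      ∃ (M : BCM.{u}) (fs : ∀ n, Xs n → M) (f : X → M),
        (∀ n, Isometry (fs n)) ∧ Isometry f ∧
        FellTendsto (fun n => Set.range (fs n)) (Set.range f) ∧
        Tendsto (fun n => fs n (Xs n).root) atTop (𝓝 (f X.root)) ∧
        VagueTendsto (fun n => (Xs n).μ.map (fs n)) (X.μ.map f),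
      -- (iii) convergence for the distance with the bounded Lipschitz part
      Tendsto (fun n => ghBLDist κ (Xs n) X) atTop (𝓝 0),
      -- (iv) Gromov-Hausdorff-vague convergence
      GHVagueTendsto Xs X] := by
  tfae_have 1 → 2 := by
    rintro ⟨M, fs, f, hF, hV⟩
    refine ⟨M.toBCM, fun n => fs n, f, fun n => (fs n).isometry, f.isometry, hF, ?_, hV⟩
    simp_rw [fun n => (fs n).map_root, f.map_root]
    exact tendsto_const_nhds
  tfae_have 2 → 1 := by
    rintro ⟨M, fs, f, hfs, hf, hF, hroot, hV⟩
    exact convergesInCommonSpace_of_tendsto_root hfs hf hF hroot hV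
  tfae_have 1 → 3 := fun h => ConvergesInCommonSpace.tendsto_ghBLDist hκ₀ h
  tfae_have 1 → 4 := fun h => ConvergesInCommonSpace.ghVagueTendsto h
  tfae_have 3 → 1 := fun h => convergesInCommonSpace_of_tendsto_dist h
    fun _ _ he => hasCloseEmbeddings_of_ghBLDist_lt hκ₀ hκ₁ he
  tfae_have 4 → 1 := fun h => convergesInCommonSpace_of_tendsto_dist h
    fun _ _ he => hasCloseEmbeddings_of_ghVagueDist_lt he
  tfae_finish
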